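/- A (deterministic) tournament on $n\ge 1$ teams is a complete directed graph on the teams, an edge $i\to j$ meaning that $i$ beats $j$. A tournament rule $r$ maps every tournament, for every $n\ge1$, to a probability distribution over its teams; it is Condorcet-consistent if a team that beats all other teams, whenever there is one, wins with probability $1$. An independent probabilistic tournament $T$ is a distribution over tournaments on a fixed set of teams under which all match outcomes are independent; $p^T_{ij}$ is the probability that $i$ beats $j$, and $r_S(T)$ is the probability that $r$, run on a tournament drawn from $T$, declares a member of $S$ the winner. Independent probabilistic tournaments $T,T'$ on the same teams are $S$-adjacent if $p^T_{ij}=p^{T'}_{ij}$ whenever $\{i,j\}\not\subseteq S$. For $\varepsilon\in[0,1/2]$ let $\mathcal T^\varepsilon$ be the class of all independent probabilistic tournaments, with any number $n \ge 1$ of teams, such that $p^T_{ij}\in[1/2-\varepsilon,1/2+\varepsilon]$ for all $i\ne j$. Put $$\alpha_S^r(T)=\sup_{T'\ S\text{-adjacent to }T}\bigl(r_S(T')-r_S(T)\bigr),\qquad \alpha_2^r(\mathcal T^\varepsilon)=\sup_{T\in\mathcal T^\varepsilon,\ |S|\le 2}\alpha_S^r(T),\qquad \alpha_2(\mathcal T^\varepsilon)=\inf_{r\text{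 Condorcet-consistent}}\alpha_2^r(\mathcal T^\varepsilon).$$ Randomized Single Elimination Bracket (RSEB) is the following rule. If one team remains, it wins. If $m\ge2$ teams remain, add $2^{\lceil\log_2 m\rceil}-m$ dummy teams that lose to every real team, play the matches of a uniformly random perfect matching of all these teams, eliminate the losers and all dummies, and recurse on the remaining real teams. Theorem 6.3. RSEB is Condorcet-consistent, and for every $\varepsilon\in[0,1/2]$, $$\alpha_2^{\mathrm{RSEB}}(\mathcal T^\varepsilon)=\alpha_2(\mathcal T^\varepsilon)=\frac{\varepsilon}{3}+\frac{2\varepsilon^2}{3}.$$ In particular, $\alpha_2^r(\mathcal T^\varepsilon)\ge \varepsilon/3+2\varepsilon^2/3$ for every Condorcet-consistent rule $r$. Moreover, for RSEB the value is a maximum: some $T\in\mathcal T^\varepsilon$, some $S$ with $|S|\le2$ and some $T'$ that is $S$-adjacent to $T$ satisfy $r_S(T')-r_S(T)=\varepsilon/3+2\varepsilon^2/3$ with $r=\mathrm{RSEB}$. -/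

import Mathlib

open Finset MeasureTheory ProbabilityTheory

/-- A (round robin, deterministic) tournament on the teams `0, …, n - 1`: a complete directed graph.
`beats i j` says that team `i` wins its match against team `j`. -/
structure Tournament (n : ℕ) where
  beats : Fin n → Fin n → Bool
  irrefl : ∀ i, beats i i = false
  complete : ∀ i j, i ≠ j → beats j i = !(beats i j)

/-- Team `i` is a Condorcet winner of `D` if it beats every other team. -/
def Tournament.IsCondorcetWinner {n : ℕ} (D : Tournament n) (i : Fin n) : Prop :=
  ∀ j, j ≠ i → D.beats i j = true

/-- The set of deterministic tournaments on `n` teams is finite; every set of them is an event. -/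
instance Tournament.instMeasurableSpace (n : ℕ) : MeasurableSpace (Tournament n) := ⊤

/-- A tournament rule maps every deterministic tournament, on any positive number of teams, to a
probability distribution over its teams (the distribution of the declared winner). -/
def TournamentRule : Type :=
  (n : ℕ) → [NeZero n] → Tournament n → PMF (Fin n)

/-- A rule is Condorcet-consistent if a Condorcet winner, when there is one, wins with
probability `1`. -/
def TournamentRule.CondorcetConsistent (r : TournamentRule) : Prop :=
  ∀ (n : ℕ) [NeZero n] (D : Tournament n) (i : Fin n), D.IsCondorcetWinner i → r n D i = 1

/-- An independent probabilistic tournament: a distribution over deterministic tournaments under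
which the outcomes of all matches (one for each pair `i < j`) are mutually independent events. -/
structure IndepTournament (n : ℕ) where
  law : PMF (Tournament n)
  indep : iIndepSet
    (fun e : {e : Fin n × Fin n // e.1 < e.2} => {D : Tournament n | D.beats e.1.1 e.1.2 = true})
    law.toMeasure

namespace IndepTournament

noncomputable section

/-- The probability that `i` beats `j`. -/
def winProb {n : ℕ} (T : IndepTournament n) (i j : Fin n) : ℝ :=
  T.law.toMeasure.real {D : Tournament n | D.beats i j = true}

/-- `T` and `T'` are `S`-adjacent: all match probabilities agree, except possibly those of matches
between two teams of `S`. -/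
def Adjacent {n : ℕ} (S : Finset (Fin n)) (T T' : IndepTournament n) : Prop :=
  ∀ i j, ¬ (i ∈ S ∧ j ∈ S) → T.winProb i j = T'.winProb i j

end

end IndepTournament

/-- A class of independent probabilistic tournaments, over all numbers of teams. -/
abbrev TournamentClass : Type := (n : ℕ) → Set (IndepTournament n)

/-- The (weakly) `ε`-bounded tournaments: every match probability is in `[1/2 - ε, 1/2 + ε]`. -/
def boundedTournaments (ε : ℝ) : TournamentClass := fun _ =>
  {T | ∀ i j, i ≠ j → T.winProb i j ∈ Set.Icc (1 / 2 - ε) (1 / 2 + ε)}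

namespace TournamentRule

noncomputable section

/-- The probability that the rule `r`, applied to a tournament drawn from `T`, declares a team of
`S` the winner (over the randomness of both `T` and `r`). -/
def coalitionProb (r : TournamentRule) {n : ℕ} [NeZero n] (S : Finset (Fin n))
    (T : IndepTournament n) : ℝ :=
  ∑ i ∈ S, (T.law.bind (fun D => r n D) i).toReal

/-- The largest gain in winning probability that the coalition `S` can get by manipulating `T` to
an `S`-adjacent `T'`. All gains lie in `[-1, 1]`, and `T' = T` is allowed. -/
def coalitionGain (r : TournamentRule) {n : ℕ} [NeZero n] (S : Finset (Fin n))
    (T : IndepTournament n) : ℝ :=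
  sSup {x | ∃ T' : IndepTournament n,
    IndepTournament.Adjacent S T T' ∧ x = r.coalitionProb S T' - r.coalitionProb S T}

/-- The largest gain under the rule `r` of a coalition of at most `k` teams, over all tournaments
of the class. -/
def manipulability (k : ℕ) (r : TournamentRule) (C : TournamentClass) : ℝ :=
  sSup {x | ∃ (n : ℕ) (_ : NeZero n) (T : IndepTournament n) (S : Finset (Fin n)),
    T ∈ C n ∧ #S ≤ k ∧ x = r.coalitionGain S T}

/-- The best possible manipulability: the infimum over all Condorcet-consistent rules. -/
def optimalManipulability (k : ℕ) (C : TournamentClass) : ℝ :=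
  sInf {x | ∃ r : TournamentRule, r.CondorcetConsistent ∧ x = manipulability k r C}

end

end TournamentRule

/-! ### Randomized Single Elimination Bracket -/

/-- A perfect matching of `X`, given by the map sending each element to its opponent: an involution
without fixed points. -/
def PerfectMatching (X : Type) : Type :=
  {opp : X → X // ∀ x, opp (opp x) = x ∧ opp x ≠ x}

instance PerfectMatching.instFintype (X : Type) [Fintype X] [DecidableEq X] :
    Fintype (PerfectMatching X) :=
  inferInstanceAs (Fintype {opp : X → X // ∀ x, opp (opp x) = x ∧ opp x ≠ x})

theorem PerfectMatching.nonempty_of_even {X : Type} [Fintype X] (h : Even (Fintype.card X)) :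
    Nonempty (PerfectMatching X) := by
  obtain ⟨m, hm⟩ := h
  have hc : Fintype.card X = Fintype.card (Fin m × Bool) := by
    simp only [Fintype.card_prod, Fintype.card_fin, Fintype.card_bool]
    omega
  let e := Fintype.equivOfCardEq hc
  refine ⟨⟨fun x => e.symm ((e x).1, !(e x).2), fun x => ⟨by simp, fun h => ?_⟩⟩⟩
  have h1 := congrArg (fun y => (e y).2) h
  simp at h1

namespace Tournament

/-- The dummy teams added to the set `A` of real teams, to bring the number of teams up
to `2 ^ ⌈log₂ #A⌉`. -/
abbrev Dummy {n : ℕ} (A : Finset (Fin n)) : Type := Fin (2 ^ Nat.clog 2 #A - #A)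

/-- The real teams `A` together with the dummy teams. -/
abbrev Entrants {n : ℕ} (A : Finset (Fin n)) : Type := A ⊕ Dummy A

theorem even_card_entrants {n : ℕ} {A : Finset (Fin n)} (h : 1 < #A) :
    Even (Fintype.card (Entrants A)) := by
  have h1 : #A ≤ 2 ^ Nat.clog 2 #A := Nat.le_pow_clog (by norm_num) _
  have h2 : Fintype.card (Entrants A) = 2 ^ Nat.clog 2 #A := by
    simp only [Fintype.card_sum, Fintype.card_coe, Fintype.card_fin]
    omega
  rw [h2]
  exact (Nat.even_pow' (Nat.clog_pos (by norm_num) h).ne').2 (by norm_num)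

/-- Does the real team `a` win its match against the given opponent? Dummies always lose. -/
def winsAgainst {n : ℕ} (D : Tournament n) {A : Finset (Fin n)} (a : Fin n) : Entrants A → Bool
  | Sum.inl b => D.beats a b
  | Sum.inr _ => true

/-- The real teams that win their match in the matching `M`. -/
def survivors {n : ℕ} (D : Tournament n) (A : Finset (Fin n)) (M : PerfectMatching (Entrants A)) :
    Finset (Fin n) :=
  (A.attach.filter (fun a => D.winsAgainst a.1 (M.1 (Sum.inl a)) = true)).map
    (Function.Embedding.subtype _)

theorem mem_survivors {n : ℕ} (D : Tournament n) (A : Finset (Fin n))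
    (M : PerfectMatching (Entrants A)) (a : Fin n) :
    a ∈ D.survivors A M ↔
      ∃ h : a ∈ A, D.winsAgainst a (M.1 (Sum.inl ⟨a, h⟩)) = true := by
  simp [survivors]

theorem survivors_nonempty {n : ℕ} (D : Tournament n) {A : Finset (Fin n)} (hA : A.Nonempty)
    (M : PerfectMatching (Entrants A)) : (D.survivors A M).Nonempty := by
  obtain ⟨a, ha⟩ := hA
  have hinv := M.2 (Sum.inl ⟨a, ha⟩)
  rcases hb : M.1 (Sum.inl ⟨a, ha⟩) with b | d
  · rw [hb] at hinv
    have hne : b.1 ≠ a := fun h => hinv.2 (by congr 1; exact Subtype.ext h)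
    cases hw : D.beats a b with
    | true => exact ⟨a, (D.mem_survivors A M a).2 ⟨ha, by rw [hb]; exact hw⟩⟩
    | false =>
      refine ⟨b, (D.mem_survivors A M b).2 ⟨b.2, ?_⟩⟩
      have : M.1 (Sum.inl ⟨b.1, b.2⟩) = Sum.inl ⟨a, ha⟩ := hinv.1
      rw [this]
      change D.beats b a = true
      rw [D.complete a b hne.symm, hw]; rfl
  · exact ⟨a, (D.mem_survivors A M a).2 ⟨ha, by rw [hb]; rfl⟩⟩

theorem card_survivors_lt {n : ℕ} (D : Tournament n) {A : Finset (Fin n)} (h : 1 < #A)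
    (M : PerfectMatching (Entrants A)) : #(D.survivors A M) < #A := by
  have hsub : D.survivors A M ⊆ A := fun a ha => ((D.mem_survivors A M a).1 ha).1
  refine Finset.card_lt_card (hsub.ssubset_of_ne fun heq => ?_)
  have hwin : ∀ a : A, D.winsAgainst a.1 (M.1 (Sum.inl a)) = true := fun a =>
    ((D.mem_survivors A M a.1).1 (by rw [heq]; exact a.2)).2
  have hdummy : ∀ a : A, ∃ d : Dummy A, M.1 (Sum.inl a) = Sum.inr d := by
    intro a
    rcases hb : M.1 (Sum.inl a) with b | d
    · exfalso
      have hinv := M.2 (Sum.inl a)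
      rw [hb] at hinv
      have hne : a.1 ≠ b.1 := fun h => hinv.2 (by congr 1; exact Subtype.ext h.symm)
      have h1 := hwin a
      have h2 := hwin b
      rw [hb] at h1
      rw [hinv.1] at h2
      have h3 : D.beats a b = true := h1
      have h4 : D.beats b a = true := h2
      rw [D.complete a b hne, h3] at h4
      simp at h4
    · exact ⟨d, rfl⟩
  choose f hf using hdummy
  have hinj : Function.Injective f := by
    intro a b hab
    have h1 := (M.2 (Sum.inl a)).1
    have h2 := (M.2 (Sum.inl b)).1
    rw [hf] at h1 h2
    rw [hab, h2] at h1
    exact (Sum.inl.inj h1).symm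
  have hcard := Fintype.card_le_of_injective f hinj
  simp only [Fintype.card_coe, Fintype.card_fin] at hcard
  have hlt : 2 ^ (Nat.clog 2 #A).pred < #A := Nat.pow_pred_clog_lt_self (by norm_num) h
  have hpos := Nat.clog_pos (by norm_num : 1 < 2) h
  have hpow : 2 ^ Nat.clog 2 #A = 2 * 2 ^ (Nat.clog 2 #A).pred := by
    rw [← pow_succ', ← Nat.succ_eq_add_one, Nat.succ_pred hpos.ne']
  omega

noncomputable section

/-- The distribution of the winner of the randomized single elimination bracket on `D`, when the
teams of `A` remain: a single team wins; otherwise dummy teams are added, a uniformly random perfect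
matching is played, and the bracket continues with the winning real teams. -/
def bracketFrom {n : ℕ} (D : Tournament n) (A : Finset (Fin n)) (hA : A.Nonempty) : PMF (Fin n) :=
  if h : 1 < #A then
    haveI : Nonempty (PerfectMatching (Entrants A)) :=
      PerfectMatching.nonempty_of_even (even_card_entrants h)
    (PMF.uniformOfFintype (PerfectMatching (Entrants A))).bind fun M =>
      D.bracketFrom (D.survivors A M) (D.survivors_nonempty hA M)
  else PMF.pure hA.choose
termination_by #A
decreasing_by exact D.card_survivors_lt h M

end

end Tournament

/-- Randomized Single Elimination Bracket. -/
noncomputable def RSEB : TournamentRule := fun n _ D =>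
  D.bracketFrom (Finset.univ : Finset (Fin n)) Finset.univ_nonempty

/-!
# Manipulability of the randomized single elimination bracket

*Upper bound.* Write `a = 1 / 2 + ε` and `b = 1 / 2 - ε`. For a coalition `{u, v}` the probability
that one of its teams wins is affine in the probability that `u` beats `v`. A manipulation moves
that probability by at most `a`, so it suffices that the outcome of this one match changes the
winning probability of the coalition by at most `(a - b) / 3 = 2 ε / 3`
(`Tournament.abs_mean_sub_le`). This change is affine in each remaining match probability, hence
all of these may be taken in `{a, b}` (`BernoulliProduct.le_of_vertices`).

The bound is then proved by induction over the rounds (`Tournament.pairGain_le`), together with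
the statement that nothing is gained unless the bracket contains a *threat*, a team against which
`u` has better chances than `v`. With `K + 2` entrants, `u` and `v` play each other with
probability `1 / (K + 1)`, and then the gain is at most `a - b`, because that is the most by which
one team can do better than another one in the same position of a bracket
(`Tournament.winBracket_sub_le`). Otherwise `u` and `v` play distinct opponents, all ordered pairs
of opponents being equally likely, and the induction hypothesis applies if both win and a threat
is left. So the induction closes (`PerfectMatching.sum_le_of_opponents`) once the probabilities of
that event, summed over all pairs of opponents, add up to at most `(K - 1) * (K - 2)`
(`Tournament.sum_surviveBound_le`). If `K = 2`, no threat is left. If there is a single threat,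
the bound holds because neither `u` nor `v` may play it; if there are several, because `v` loses
to each of them with probability `a`. The induction works with probabilities instead of single
tournaments since the matches of later rounds are independent of those already played
(`Tournament.mean_champProb_survivors`).

*Lower bound.* For three teams each of which beats the next one, cyclically, with probability `a`,
the gains of the three pairs from fixing their match in favour of the weaker team add up to
`a * (a - b)` for every Condorcet-consistent rule, so some pair gains a third of this
(`exists_gain_ge`). For RSEB the two bounds together show that this pair attains the supremum.
-/

/-! ### Products of Bernoulli distributions -/

namespace BernoulliProduct

variable {ι : Type*} [Fintype ι]

/-- The probability of the outcome `ω` of independent coins, coin `e` showing `true` with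
probability `p e`. -/
noncomputable def weight (p : ι → ℝ) (ω : ι → Bool) : ℝ :=
  ∏ e, if ω e = true then p e else 1 - p e

theorem weight_nonneg {p : ι → ℝ} (hp : ∀ e, p e ∈ Set.Icc (0 : ℝ) 1) (ω : ι → Bool) :
    0 ≤ weight p ω :=
  Finset.prod_nonneg fun e _ => by
    split_ifs
    · exact (hp e).1
    · linarith [(hp e).2]

variable [DecidableEq ι]

/-- The expectation of `f` under independent coins with success probabilities `p`. -/
noncomputable def mean (p : ι → ℝ) (f : (ι → Bool) → ℝ) : ℝ :=
  ∑ ω, weight p ω * f ω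

theorem sum_weight (p : ι → ℝ) : ∑ ω, weight p ω = 1 := by
  have h := Finset.prod_univ_sum (fun _ : ι => (univ : Finset Bool))
    (fun e c => if c = true then p e else 1 - p e)
  rw [Fintype.piFinset_univ] at h
  unfold weight
  rw [← h]
  exact Finset.prod_eq_one fun e _ => by simp

theorem mean_const (p : ι → ℝ) (c : ℝ) : mean p (fun _ => c) = c := by
  simp [mean, ← Finset.sum_mul, sum_weight]

theorem mean_add (p : ι → ℝ) (f g : (ι → Bool) → ℝ) :
    mean p (fun ω => f ω + g ω) = mean p f + mean p g := by
  simp [mean, mul_add, Finset.sum_add_distrib]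

theorem mean_sub (p : ι → ℝ) (f g : (ι → Bool) → ℝ) :
    mean p (fun ω => f ω - g ω) = mean p f - mean p g := by
  simp [mean, mul_sub, Finset.sum_sub_distrib]

theorem mean_mul_left (p : ι → ℝ) (c : ℝ) (f : (ι → Bool) → ℝ) :
    mean p (fun ω => c * f ω) = c * mean p f := by
  simp only [mean, Finset.mul_sum]
  exact Finset.sum_congr rfl fun _ _ => by ring

theorem mean_sum {κ : Type*} (p : ι → ℝ) (s : Finset κ) (f : κ → (ι → Bool) → ℝ) :
    mean p (fun ω => ∑ k ∈ s, f k ω) = ∑ k ∈ s, mean p (f k) := by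
  simp only [mean, Finset.mul_sum]
  exact Finset.sum_comm

theorem mean_mono {p : ι → ℝ} (hp : ∀ e, p e ∈ Set.Icc (0 : ℝ) 1) {f g : (ι → Bool) → ℝ}
    (h : ∀ ω, f ω ≤ g ω) : mean p f ≤ mean p g :=
  Finset.sum_le_sum fun ω _ => mul_le_mul_of_nonneg_left (h ω) (weight_nonneg hp ω)

theorem mean_le {p : ι → ℝ} (hp : ∀ e, p e ∈ Set.Icc (0 : ℝ) 1) {f : (ι → Bool) → ℝ} {c : ℝ}
    (h : ∀ ω, f ω ≤ c) : mean p f ≤ c :=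
  (mean_mono hp h).trans (mean_const p c).le

theorem le_mean {p : ι → ℝ} (hp : ∀ e, p e ∈ Set.Icc (0 : ℝ) 1) {f : (ι → Bool) → ℝ} {c : ℝ}
    (h : ∀ ω, c ≤ f ω) : c ≤ mean p f :=
  (mean_const p c).ge.trans (mean_mono hp h)

open Classical in
/-- Exchanging the coins of `s` between two independent samples does not change their joint law, if
these coins have the same bias in both samples. -/
theorem sum_sum_swap {p q : ι → ℝ} {s : Set ι} (hpq : ∀ e ∈ s, p e = q e)
    (F : (ι → Bool) → (ι → Bool) → ℝ) :
    ∑ ω, ∑ ω', weight p ω * weight q ω' * F ω ω' =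
      ∑ ω, ∑ ω', weight p ω * weight q ω' * F (s.piecewise ω' ω) (s.piecewise ω ω') := by
  let Φ : (ι → Bool) × (ι → Bool) → (ι → Bool) × (ι → Bool) :=
    fun x => (s.piecewise x.2 x.1, s.piecewise x.1 x.2)
  have hΦ : Function.Involutive Φ := by
    intro x
    ext e <;> by_cases he : e ∈ s <;> simp [Φ, he]
  have hw : ∀ ω ω', weight p (s.piecewise ω' ω) * weight q (s.piecewise ω ω') =
      weight p ω * weight q ω' := by
    intro ω ω'
    simp only [weight, ← Finset.prod_mul_distrib]
    refine Finset.prod_congr rfl fun e _ => ?_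
    by_cases he : e ∈ s
    · simp only [he, Set.piecewise_eq_of_mem, hpq e he]
      ring
    · simp [he]
  rw [← Fintype.sum_prod_type', ← Fintype.sum_prod_type']
  refine Fintype.sum_equiv (Function.Involutive.toPerm Φ hΦ) _ _ fun x => ?_
  have h1 : (Function.Involutive.toPerm Φ hΦ) x = Φ x := rfl
  have h2 : Φ (Φ x) = x := hΦ x
  have h3 : s.piecewise (Φ x).2 (Φ x).1 = x.1 := congrArg Prod.fst h2
  have h4 : s.piecewise (Φ x).1 (Φ x).2 = x.2 := congrArg Prod.snd h2
  rw [h1, h3, h4, hw x.1 x.2]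

theorem mean_mul_mean (p q : ι → ℝ) (f g : (ι → Bool) → ℝ) :
    mean p f * mean q g = ∑ ω, ∑ ω', weight p ω * weight q ω' * (f ω * g ω') := by
  simp only [mean, Finset.sum_mul_sum]
  exact Finset.sum_congr rfl fun _ _ => Finset.sum_congr rfl fun _ _ => by ring

/-- Only the biases of the coins that `f` reads matter for its expectation. -/
theorem mean_congr {p q : ι → ℝ} {s : Set ι} (hpq : ∀ e ∈ s, p e = q e)
    {f : (ι → Bool) → ℝ} (hf : DependsOn f s) : mean p f = mean q f := by
  classical
  have h1 := mean_mul_mean p q f (fun _ => 1)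
  have h2 := mean_mul_mean p q (fun _ => 1) f
  rw [mean_const, mul_one] at h1
  rw [mean_const, one_mul] at h2
  rw [h1, h2, sum_sum_swap hpq]
  refine Finset.sum_congr rfl fun ω _ => Finset.sum_congr rfl fun ω' _ => ?_
  have : f (s.piecewise ω' ω) = f ω' := hf fun e he => by simp [he]
  rw [this]
  ring

/-- Functions of disjoint sets of coins are uncorrelated. -/
theorem mean_mul {p : ι → ℝ} {s t : Set ι} (hst : Disjoint s t)
    {f g : (ι → Bool) → ℝ} (hf : DependsOn f s) (hg : DependsOn g t) :
    mean p (fun ω => f ω * g ω) = mean p f * mean p g := by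
  classical
  have h2 := mean_mul_mean p p (fun _ => 1) (fun ω => f ω * g ω)
  rw [mean_const, one_mul] at h2
  rw [h2, mean_mul_mean, sum_sum_swap (s := s) (fun _ _ => rfl) (fun ω ω' => f ω * g ω')]
  refine Finset.sum_congr rfl fun ω _ => Finset.sum_congr rfl fun ω' _ => ?_
  have h3 : f (s.piecewise ω' ω) = f ω' := hf fun e he => by simp [he]
  have h4 : g (s.piecewise ω ω') = g ω' := hg fun e he => by
    have : e ∉ s := fun h => Set.disjoint_left.1 hst h he
    simp [this]
  rw [h3, h4, one_mul]

theorem weight_update (p : ι → ℝ) (e : ι) (t : ℝ) (ω : ι → Bool) :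
    weight (Function.update p e t) ω =
      (if ω e = true then t else 1 - t) *
        ∏ e' ∈ univ.erase e, if ω e' = true then p e' else 1 - p e' := by
  unfold weight
  rw [← Finset.mul_prod_erase univ _ (mem_univ e)]
  congr 1
  · simp
  · refine Finset.prod_congr rfl fun e' he' => ?_
    rw [Function.update_of_ne (Finset.ne_of_mem_erase he')]

/-- The expectation is an affine function of each single bias. -/
theorem mean_update (p : ι → ℝ) (e : ι) (t : ℝ) (f : (ι → Bool) → ℝ) :
    mean (Function.update p e t) f =
      t * mean (Function.update p e 1) f + (1 - t) * mean (Function.update p e 0) f := by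
  simp only [mean, Finset.mul_sum, ← Finset.sum_add_distrib]
  refine Finset.sum_congr rfl fun ω _ => ?_
  simp only [weight_update]
  split_ifs <;> ring

theorem mean_coin (p : ι → ℝ) (e : ι) :
    mean p (fun ω => if ω e = true then 1 else 0) = p e := by
  have h := mean_update p e (p e) (fun ω => if ω e = true then (1 : ℝ) else 0)
  rw [Function.update_eq_self] at h
  have h1 : mean (Function.update p e 1) (fun ω => if ω e = true then (1 : ℝ) else 0) = 1 := by
    refine Eq.trans ?_ (sum_weight (Function.update p e 1))
    refine Finset.sum_congr rfl fun ω _ => ?_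
    by_cases hω : ω e = true <;> simp [weight_update, hω]
  have h0 : mean (Function.update p e 0) (fun ω => if ω e = true then (1 : ℝ) else 0) = 0 := by
    refine Finset.sum_eq_zero fun ω _ => ?_
    by_cases hω : ω e = true <;> simp [weight_update, hω]
  rw [h, h1, h0]
  ring

/-- A function that is affine in each variable is at most `c` on a box if it is at most `c` at the
vertices of the box. -/
theorem le_of_vertices {Φ : (ι → ℝ) → ℝ}
    (hΦ : ∀ p e t, Φ (Function.update p e t) =
      t * Φ (Function.update p e 1) + (1 - t) * Φ (Function.update p e 0))
    {a b c : ℝ} (hV : ∀ q : ι → ℝ, (∀ e, q e = a ∨ q e = b) → Φ q ≤ c)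
    {p : ι → ℝ} (hp : ∀ e, p e ∈ Set.Icc b a) : Φ p ≤ c := by
  suffices H : ∀ (s : Finset ι) (q : ι → ℝ), (∀ e, q e ∈ Set.Icc b a) →
      (∀ e ∉ s, q e = a ∨ q e = b) → Φ q ≤ c from H univ p hp (by simp)
  intro s
  induction s using Finset.induction_on with
  | empty => exact fun q _ hq => hV q fun e => hq e (by simp)
  | insert e s _ ih =>
    intro q hq hqs
    have hab : b ≤ a := (hq e).1.trans (hq e).2
    have key : ∀ t, t = a ∨ t = b → Φ (Function.update q e t) ≤ c := by
      intro t ht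
      refine ih _ (fun e' => ?_) (fun e' he' => ?_)
      · by_cases h : e' = e
        · subst h
          rw [Function.update_self]
          rcases ht with rfl | rfl
          · exact ⟨hab, le_rfl⟩
          · exact ⟨le_rfl, hab⟩
        · rw [Function.update_of_ne h]; exact hq e'
      · by_cases h : e' = e
        · subst h
          rwa [Function.update_self]
        · rw [Function.update_of_ne h]
          exact hqs e' (by simp [h, he'])
    have ha := key a (Or.inl rfl)
    have hb := key b (Or.inr rfl)
    have h := hΦ q e (q e)
    rw [Function.update_eq_self] at h
    rw [hΦ] at ha hb
    obtain ⟨h1, h2⟩ := hq e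
    -- an affine function of `q e` is bounded by its larger value at the ends `a` and `b`
    rcases le_total (Φ (Function.update q e 0)) (Φ (Function.update q e 1)) with h3 | h3 <;>
      nlinarith

end BernoulliProduct

/-! ### The bracket on a tournament with independent matches -/

namespace Tournament

open BernoulliProduct

variable {n : ℕ}

/-- The matches of the round robin on `n` teams: pairs of teams `i < j`. -/
abbrev Match (n : ℕ) : Type := {e : Fin n × Fin n // e.1 < e.2}

/-- The tournament in which `ω e = true` says that the smaller team of `e` beats the larger one. -/
def ofOutcomes (ω : Match n → Bool) : Tournament n where
  beats i j := if h : i < j then ω ⟨(i, j), h⟩ else if h : j < i then !ω ⟨(j, i), h⟩ else false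
  irrefl i := by simp
  complete i j hij := by
    rcases lt_or_gt_of_ne hij with h | h
    · simp [h, h.not_gt]
    · simp [h, h.not_gt]

/-- The probability that `i` beats `j`, when the smaller team of each match `e` wins with
probability `p e`; it is `0` for `i = j`. -/
noncomputable def beatProb (p : Match n → ℝ) (i j : Fin n) : ℝ :=
  if h : i < j then p ⟨(i, j), h⟩ else if h : j < i then 1 - p ⟨(j, i), h⟩ else 0

/-- The match between `i` and `j`, as a set of at most one element. -/
def matchOf (i j : Fin n) : Set (Match n) :=
  {e | (e.1.1 = i ∧ e.1.2 = j) ∨ (e.1.1 = j ∧ e.1.2 = i)}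

theorem matchOf_comm (i j : Fin n) : matchOf i j = matchOf j i := by
  ext e
  exact or_comm

theorem disjoint_matchOf {i j k l : Fin n} (h1 : k ≠ i ∨ l ≠ j) (h2 : k ≠ j ∨ l ≠ i) :
    Disjoint (matchOf i j) (matchOf k l) := by
  rw [Set.disjoint_left]
  rintro e (⟨rfl, rfl⟩ | ⟨rfl, rfl⟩) (⟨h3, h4⟩ | ⟨h3, h4⟩) <;> simp_all

theorem dependsOn_beats (i j : Fin n) :
    DependsOn (fun ω : Match n → Bool => (ofOutcomes ω).beats i j) (matchOf i j) := by
  intro ω ω' h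
  simp only [ofOutcomes]
  split_ifs with h1 h2
  · exact h _ (Or.inl ⟨rfl, rfl⟩)
  · rw [h _ (Or.inr ⟨rfl, rfl⟩)]
  · rfl

theorem mean_beats (p : Match n → ℝ) (i j : Fin n) :
    mean p (fun ω => if (ofOutcomes ω).beats i j = true then 1 else 0) = beatProb p i j := by
  by_cases h1 : i < j
  · simpa only [ofOutcomes, beatProb, dif_pos h1] using mean_coin p _
  by_cases h2 : j < i
  · simp only [ofOutcomes, beatProb, dif_neg h1, dif_pos h2]
    rw [← mean_coin p, ← mean_const p 1, ← mean_sub, mean_const]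
    congr 1
    funext ω
    cases ω ⟨(j, i), h2⟩ <;> simp
  · simp [ofOutcomes, beatProb, h1, h2, mean_const]

theorem beatProb_mem {p : Match n → ℝ} (hp : ∀ e, p e ∈ Set.Icc (0 : ℝ) 1) (i j : Fin n) :
    beatProb p i j ∈ Set.Icc (0 : ℝ) 1 := by
  simp only [beatProb]
  split_ifs with h1 h2
  · exact hp _
  · obtain ⟨h3, h4⟩ := hp ⟨(j, i), h2⟩
    constructor <;> linarith
  · simp

theorem beatProb_add {p : Match n → ℝ} {i j : Fin n} (h : i ≠ j) :
    beatProb p i j + beatProb p j i = 1 := by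
  simp only [beatProb]
  rcases lt_or_gt_of_ne h with h | h <;> simp [h, h.not_gt]

theorem beats_or {D : Tournament n} {i j : Fin n} (h : i ≠ j) :
    D.beats j i = true ↔ ¬ D.beats i j = true := by
  rw [D.complete i j h]
  simp

/-! #### Survivors of a round -/

/-- The probability that team `i` wins its match against an opponent. -/
noncomputable def passProb (p : Match n → ℝ) {A : Finset (Fin n)} (i : Fin n) : Entrants A → ℝ
  | Sum.inl b => beatProb p i b
  | Sum.inr _ => 1

/-- The match between team `i` and an opponent, as a set of at most one element; matches against
dummies are not random. -/
def passMatch {A : Finset (Fin n)} (i : Fin n) : Entrants A → Set (Match n)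
  | Sum.inl b => matchOf i b
  | Sum.inr _ => ∅

theorem dependsOn_winsAgainst {A : Finset (Fin n)} (i : Fin n) (x : Entrants A) :
    DependsOn (fun ω : Match n → Bool => (ofOutcomes ω).winsAgainst i x) (passMatch i x) := by
  rcases x with b | d
  · exact dependsOn_beats i b
  · exact fun _ _ _ => rfl

theorem mean_winsAgainst (p : Match n → ℝ) {A : Finset (Fin n)} (i : Fin n) (x : Entrants A) :
    mean p (fun ω => if (ofOutcomes ω).winsAgainst i x = true then 1 else 0) =
      passProb p i x := by
  rcases x with b | d
  · exact mean_beats p i b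
  · simp [winsAgainst, passProb, mean_const]

theorem passProb_mem {p : Match n → ℝ} (hp : ∀ e, p e ∈ Set.Icc (0 : ℝ) 1) {A : Finset (Fin n)}
    (i : Fin n) (x : Entrants A) : passProb p i x ∈ Set.Icc (0 : ℝ) 1 := by
  rcases x with b | d
  · exact beatProb_mem hp i b
  · simp [passProb]

theorem survivors_subset (D : Tournament n) (A : Finset (Fin n))
    (M : PerfectMatching (Entrants A)) : D.survivors A M ⊆ A :=
  fun a ha => ((D.mem_survivors A M a).1 ha).1

theorem mem_survivors_of_mem (D : Tournament n) {A : Finset (Fin n)}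
    (M : PerfectMatching (Entrants A)) {a : Fin n} (ha : a ∈ A) :
    a ∈ D.survivors A M ↔ D.winsAgainst a (M.1 (Sum.inl ⟨a, ha⟩)) = true := by
  rw [mem_survivors]
  exact ⟨fun ⟨_, h⟩ => h, fun h => ⟨ha, h⟩⟩

theorem opp_ne {X : Type} (M : PerfectMatching X) (x : X) : M.1 x ≠ x := (M.2 x).2

theorem opp_opp {X : Type} (M : PerfectMatching X) (x : X) : M.1 (M.1 x) = x := (M.2 x).1

theorem opp_eq_iff {X : Type} (M : PerfectMatching X) {x y : X} : M.1 x = y ↔ M.1 y = x := by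
  constructor <;> rintro rfl <;> exact opp_opp M _

/-- The matches of a round. -/
def roundMatches (A : Finset (Fin n)) (M : PerfectMatching (Entrants A)) : Set (Match n) :=
  {e | ∃ (h1 : e.1.1 ∈ A) (h2 : e.1.2 ∈ A), M.1 (Sum.inl ⟨e.1.1, h1⟩) = Sum.inl ⟨e.1.2, h2⟩}

theorem passMatch_subset {A : Finset (Fin n)} (M : PerfectMatching (Entrants A)) (a : A) :
    passMatch a.1 (M.1 (Sum.inl a)) ⊆ roundMatches A M := by
  intro e he
  rcases hb : M.1 (Sum.inl a) with b | d
  · rw [hb] at he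
    rcases he with ⟨h1, h2⟩ | ⟨h1, h2⟩
    · refine ⟨h1 ▸ a.2, h2 ▸ b.2, ?_⟩
      convert hb using 3; exact Subtype.ext ‹_›
    · refine ⟨h1 ▸ b.2, h2 ▸ a.2, ?_⟩
      rw [opp_eq_iff] at hb
      convert hb using 3; exact Subtype.ext ‹_›
  · rw [hb] at he
    exact he.elim

theorem survivors_eq_of_winsAgainst {D D' : Tournament n} {A : Finset (Fin n)}
    (M : PerfectMatching (Entrants A))
    (h : ∀ a : A, D.winsAgainst a.1 (M.1 (Sum.inl a)) = D'.winsAgainst a.1 (M.1 (Sum.inl a))) :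
    D.survivors A M = D'.survivors A M := by
  ext a
  rw [mem_survivors, mem_survivors]
  exact exists_congr fun ha => by rw [h ⟨a, ha⟩]

theorem dependsOn_survivors {A : Finset (Fin n)} (M : PerfectMatching (Entrants A)) :
    DependsOn (fun ω : Match n → Bool => (ofOutcomes ω).survivors A M) (roundMatches A M) :=
  fun _ _ h => survivors_eq_of_winsAgainst M fun a =>
    dependsOn_winsAgainst a.1 _ fun e he => h e (passMatch_subset M a he)

/-- Two survivors of a round have not played each other. -/
theorem not_mem_roundMatches (D : Tournament n) {A : Finset (Fin n)}
    (M : PerfectMatching (Entrants A)) {e : Match n} (h1 : e.1.1 ∈ D.survivors A M)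
    (h2 : e.1.2 ∈ D.survivors A M) : e ∉ roundMatches A M := by
  rintro ⟨h3, h4, h5⟩
  rw [mem_survivors_of_mem D M h3, h5] at h1
  rw [mem_survivors_of_mem D M h4, (opp_eq_iff M).1 h5] at h2
  exact (beats_or e.2.ne).1 h2 h1

/-! #### The probability of winning the bracket -/

/-- The probability that `i` wins the bracket on `D` when the teams of `A` remain; it is `0` when
no team remains. -/
noncomputable def champProb (D : Tournament n) (A : Finset (Fin n)) (i : Fin n) : ℝ :=
  if h : A.Nonempty then (D.bracketFrom A h i).toReal else 0

theorem champProb_nonneg (D : Tournament n) (A : Finset (Fin n)) (i : Fin n) :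
    0 ≤ D.champProb A i := by
  unfold champProb
  split_ifs <;> simp

theorem champProb_le_one (D : Tournament n) (A : Finset (Fin n)) (i : Fin n) :
    D.champProb A i ≤ 1 := by
  unfold champProb
  split_ifs
  · exact ENNReal.toReal_le_of_le_ofReal zero_le_one (by simpa using PMF.coe_le_one _ i)
  · exact zero_le_one

theorem champProb_singleton (D : Tournament n) (x i : Fin n) :
    D.champProb {x} i = if i = x then 1 else 0 := by
  have hx : ({x} : Finset (Fin n)).Nonempty := ⟨x, by simp⟩
  have hc : hx.choose = x := by simpa using hx.choose_spec
  rw [champProb, dif_pos hx, bracketFrom, dif_neg (by simp), hc, PMF.pure_apply]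
  split_ifs <;> simp

theorem champProb_step (D : Tournament n) {A : Finset (Fin n)} (hA : 1 < #A) (i : Fin n) :
    D.champProb A i = (∑ M : PerfectMatching (Entrants A), D.champProb (D.survivors A M) i) /
      Fintype.card (PerfectMatching (Entrants A)) := by
  have hne : A.Nonempty := Finset.card_pos.1 (by omega)
  have : Nonempty (PerfectMatching (Entrants A)) :=
    PerfectMatching.nonempty_of_even (even_card_entrants hA)
  rw [champProb, dif_pos hne, bracketFrom, dif_pos hA, PMF.bind_apply, tsum_fintype,
    ENNReal.toReal_sum, Finset.sum_div]
  · refine Finset.sum_congr rfl fun M _ => ?_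
    rw [champProb, dif_pos (D.survivors_nonempty hne M), PMF.uniformOfFintype_apply,
      ENNReal.toReal_mul, ENNReal.toReal_inv, ENNReal.toReal_natCast, div_eq_inv_mul]
  · intro M _
    exact ENNReal.mul_ne_top (PMF.apply_ne_top _ _) (PMF.apply_ne_top _ _)

theorem card_eq_one_of_not {A : Finset (Fin n)} (h : ¬ 1 < #A) (hne : A.Nonempty) :
    ∃ x, A = {x} :=
  Finset.card_eq_one.1 (by have := hne.card_pos; omega)

theorem champProb_eq_zero (D : Tournament n) (A : Finset (Fin n)) {i : Fin n} (hi : i ∉ A) :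
    D.champProb A i = 0 := by
  induction A using Finset.strongInduction with
  | H A ih =>
    by_cases hA : 1 < #A
    · rw [champProb_step D hA, Finset.sum_eq_zero, zero_div]
      intro M _
      have hs := D.survivors_subset A M
      exact ih _ (hs.ssubset_of_ne fun h => (D.card_survivors_lt hA M).ne (by rw [h]))
        fun h => hi (hs h)
    · by_cases hne : A.Nonempty
      · obtain ⟨x, rfl⟩ := card_eq_one_of_not hA hne
        rw [champProb_singleton, if_neg (by simpa using hi)]
      · rw [champProb, dif_neg hne]

/-- The bracket on `A` reads only the matches between teams of `A`. -/
theorem champProb_congr {D D' : Tournament n} (A : Finset (Fin n))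
    (h : ∀ i ∈ A, ∀ j ∈ A, D.beats i j = D'.beats i j) (i : Fin n) :
    D.champProb A i = D'.champProb A i := by
  induction A using Finset.strongInduction with
  | H A ih =>
    by_cases hA : 1 < #A
    · rw [champProb_step D hA, champProb_step D' hA]
      congr 1
      refine Finset.sum_congr rfl fun M _ => ?_
      have hs : D.survivors A M = D'.survivors A M := by
        refine survivors_eq_of_winsAgainst M fun a => ?_
        rcases M.1 (Sum.inl a) with b | d
        · exact h a a.2 b b.2
        · rfl
      have hsub := D'.survivors_subset A M
      rw [hs]
      exact ih _ (hsub.ssubset_of_ne fun h => (D'.card_survivors_lt hA M).ne (by rw [h]))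
        fun i hi j hj => h i (hsub hi) j (hsub hj)
    · by_cases hne : A.Nonempty
      · obtain ⟨x, rfl⟩ := card_eq_one_of_not hA hne
        rw [champProb_singleton, champProb_singleton]
      · rw [champProb, champProb, dif_neg hne, dif_neg hne]

/-- The matches between two teams of `A`. -/
def matchesIn (A : Finset (Fin n)) : Set (Match n) := {e | e.1.1 ∈ A ∧ e.1.2 ∈ A}

theorem dependsOn_champProb (A : Finset (Fin n)) (i : Fin n) :
    DependsOn (fun ω : Match n → Bool => (ofOutcomes ω).champProb A i) (matchesIn A) := by
  intro ω ω' h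
  refine champProb_congr A (fun j hj k hk => dependsOn_beats j k fun e he => h e ?_) i
  rcases he with ⟨h1, h2⟩ | ⟨h1, h2⟩
  · exact ⟨h1 ▸ hj, h2 ▸ hk⟩
  · exact ⟨h1 ▸ hk, h2 ▸ hj⟩

/-- The probability that `i` wins the bracket from `A`, over the bracket and the independent match
outcomes. -/
noncomputable def winBracket (p : Match n → ℝ) (A : Finset (Fin n)) (i : Fin n) : ℝ :=
  mean p fun ω => (ofOutcomes ω).champProb A i

theorem winBracket_congr {p q : Match n → ℝ} {A : Finset (Fin n)}
    (h : ∀ e ∈ matchesIn A, p e = q e) (i : Fin n) : winBracket p A i = winBracket q A i :=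
  mean_congr h (dependsOn_champProb A i)

theorem winBracket_eq_zero (p : Match n → ℝ) {A : Finset (Fin n)} {i : Fin n} (hi : i ∉ A) :
    winBracket p A i = 0 := by
  simp [winBracket, champProb_eq_zero _ A hi, mean_const]

theorem winBracket_singleton (p : Match n → ℝ) (i : Fin n) : winBracket p {i} i = 1 := by
  simp [winBracket, champProb_singleton, mean_const]

theorem winBracket_nonneg {p : Match n → ℝ} (hp : ∀ e, p e ∈ Set.Icc (0 : ℝ) 1)
    (A : Finset (Fin n)) (i : Fin n) : 0 ≤ winBracket p A i :=
  le_mean hp fun _ => champProb_nonneg _ _ _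

theorem winBracket_le_one {p : Match n → ℝ} (hp : ∀ e, p e ∈ Set.Icc (0 : ℝ) 1)
    (A : Finset (Fin n)) (i : Fin n) : winBracket p A i ≤ 1 :=
  mean_le hp fun _ => champProb_le_one _ _ _

/-- The matches of later rounds are independent of those already played: survivors play each other
for the first time. -/
theorem mean_champProb_survivors (p : Match n → ℝ) {A : Finset (Fin n)}
    (M : PerfectMatching (Entrants A)) (i : Fin n) :
    mean p (fun ω => (ofOutcomes ω).champProb ((ofOutcomes ω).survivors A M) i) =
      mean p (fun ω => winBracket p ((ofOutcomes ω).survivors A M) i) := by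
  have split : ∀ F : (Match n → Bool) → Finset (Fin n) → ℝ,
      mean p (fun ω => F ω ((ofOutcomes ω).survivors A M)) =
        ∑ B, mean p (fun ω => (if (ofOutcomes ω).survivors A M = B then 1 else 0) * F ω B) := by
    intro F
    rw [← mean_sum]
    congr 1
    funext ω
    simp
  rw [split fun ω B => (ofOutcomes ω).champProb B i, split fun _ B => winBracket p B i]
  refine Finset.sum_congr rfl fun B _ => ?_
  by_cases hB : ∃ ω : Match n → Bool, (ofOutcomes ω).survivors A M = B
  · obtain ⟨ω₀, rfl⟩ := hB
    set B := (ofOutcomes ω₀).survivors A M with hB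
    have hdisj : Disjoint (roundMatches A M) (matchesIn B) := by
      rw [Set.disjoint_right]
      rintro e ⟨h1, h2⟩
      exact not_mem_roundMatches _ M h1 h2
    have hdep : DependsOn (fun ω : Match n → Bool =>
        if (ofOutcomes ω).survivors A M = B then (1 : ℝ) else 0) (roundMatches A M) := by
      intro ω ω' h
      have := dependsOn_survivors M h
      simp only at this ⊢
      rw [this]
    rw [mean_mul hdisj hdep (dependsOn_champProb B i), mul_comm (mean p _),
      ← winBracket, ← mean_mul_left]
    congr 1
    funext ω
    ring
  · have : ∀ ω : Match n → Bool, (ofOutcomes ω).survivors A M ≠ B := fun ω h => hB ⟨ω, h⟩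
    simp [this]

theorem winBracket_step (p : Match n → ℝ) {A : Finset (Fin n)} (hA : 1 < #A) (i : Fin n) :
    winBracket p A i = (∑ M : PerfectMatching (Entrants A),
      mean p fun ω => winBracket p ((ofOutcomes ω).survivors A M) i) /
        Fintype.card (PerfectMatching (Entrants A)) := by
  simp_rw [← mean_champProb_survivors]
  rw [winBracket, div_eq_inv_mul, ← mean_sum, ← mean_mul_left]
  refine congrArg (mean p) (funext fun ω => ?_)
  rw [champProb_step _ hA, div_eq_inv_mul]

end Tournament

/-! ### Counting perfect matchings -/

namespace PerfectMatching

/-- Relabelling a perfect matching along a bijection. -/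
def relabel {X Y : Type} (σ : X ≃ Y) : PerfectMatching X ≃ PerfectMatching Y where
  toFun M := ⟨fun y => σ (M.1 (σ.symm y)), fun y => by
    constructor
    · simp [(M.2 _).1]
    · intro h
      exact (M.2 (σ.symm y)).2 (σ.eq_symm_apply.2 h)⟩
  invFun M := ⟨fun x => σ.symm (M.1 (σ x)), fun x => by
    constructor
    · simp [(M.2 _).1]
    · intro h
      exact (M.2 (σ x)).2 (σ.symm_apply_eq.1 h)⟩
  left_inv M := Subtype.ext (funext fun x => by simp)
  right_inv M := Subtype.ext (funext fun x => by simp)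

@[simp]
theorem relabel_apply {X Y : Type} (σ : X ≃ Y) (M : PerfectMatching X) (x : X) :
    (relabel σ M).1 (σ x) = σ (M.1 x) := by
  change σ (M.1 (σ.symm (σ x))) = _
  rw [σ.symm_apply_apply]

variable {X : Type} [Fintype X] [DecidableEq X]

theorem card_opp_eq (σ : Equiv.Perm X) (x y : X) :
    #{M : PerfectMatching X | M.1 x = y} = #{M : PerfectMatching X | M.1 (σ x) = σ y} := by
  refine Finset.card_equiv (relabel σ) fun M => ?_
  simp

theorem card_opp_opp_eq (σ : Equiv.Perm X) (x y x' y' : X) :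
    #{M : PerfectMatching X | M.1 x = y ∧ M.1 x' = y'} =
      #{M : PerfectMatching X | M.1 (σ x) = σ y ∧ M.1 (σ x') = σ y'} := by
  refine Finset.card_equiv (relabel σ) fun M => ?_
  simp

/-- All opponents of `u` are equally likely. -/
theorem card_eq_mul_card_opp {u v : X} (huv : u ≠ v) :
    (Fintype.card (PerfectMatching X) : ℝ) =
      ((Fintype.card X : ℝ) - 1) * #{M : PerfectMatching X | M.1 u = v} := by
  have h := Finset.card_eq_sum_card_fiberwise (s := (univ : Finset (PerfectMatching X)))
    (f := fun M => M.1 u) (t := univ.erase u) (fun M _ => by simp [(M.2 u).2])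
  have h2 : ∀ w ∈ univ.erase u, #{M : PerfectMatching X | M.1 u = w} =
      #{M : PerfectMatching X | M.1 u = v} := by
    intro w hw
    rw [card_opp_eq (Equiv.swap w v) u w,
      Equiv.swap_apply_of_ne_of_ne (Finset.ne_of_mem_erase hw).symm huv, Equiv.swap_apply_left]
  rw [Finset.sum_congr rfl h2, Finset.sum_const, Finset.card_erase_of_mem (mem_univ u),
    Finset.card_univ, Finset.card_univ, smul_eq_mul] at h
  have h3 : 1 ≤ Fintype.card X := Fintype.card_pos_iff.2 ⟨u⟩
  rw [h]
  push_cast [h3]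
  ring

/-- All pairs of distinct opponents of `u` and `v`, when these do not play each other, are equally
likely. -/
theorem card_opp_opp_const {u v : X} {y z y' z' : X} (hyz : y ≠ z) (hyz' : y' ≠ z')
    (hy : y ≠ u ∧ y ≠ v) (hz : z ≠ u ∧ z ≠ v) (hy' : y' ≠ u ∧ y' ≠ v) (hz' : z' ≠ u ∧ z' ≠ v) :
    #{M : PerfectMatching X | M.1 u = y ∧ M.1 v = z} =
      #{M : PerfectMatching X | M.1 u = y' ∧ M.1 v = z'} := by
  -- a permutation that fixes `u` and `v` and sends `(y, z)` to `(y', z')`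
  set τ := Equiv.swap y y' with hτ
  have hτz : τ z ≠ y' := by
    intro h
    rw [hτ, Equiv.swap_apply_eq_iff, Equiv.swap_apply_right] at h
    exact hyz h.symm
  have fix : ∀ w, w ≠ y → w ≠ y' → τ w = w := fun w => Equiv.swap_apply_of_ne_of_ne
  have hu : τ u = u := fix u hy.1.symm hy'.1.symm
  have hv : τ v = v := fix v hy.2.symm hy'.2.symm
  have hzu : τ z ≠ u := fun h => hz.1 (τ.injective (h.trans hu.symm))
  have hzv : τ z ≠ v := fun h => hz.2 (τ.injective (h.trans hv.symm))
  have hty : τ y = y' := Equiv.swap_apply_left _ _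
  rw [card_opp_opp_eq τ u y v z, card_opp_opp_eq (Equiv.swap (τ z) z') (τ u) (τ y) (τ v) (τ z), hu,
    hv, hty, Equiv.swap_apply_left, Equiv.swap_apply_of_ne_of_ne hzu.symm hz'.1.symm,
    Equiv.swap_apply_of_ne_of_ne hzv.symm hz'.2.symm, Equiv.swap_apply_of_ne_of_ne hτz.symm hyz']

/-- A bound on the average over all perfect matchings of a quantity `h` which is at most `3 * c`
when `u` plays `v`, and at most `c * φ y z` when `u` plays `y` and `v` plays `z`. -/
theorem sum_le_of_opponents {u v : X} (huv : u ≠ v) (hcard : 4 ≤ Fintype.card X)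
    {h : PerfectMatching X → ℝ} {φ : X → X → ℝ} {c : ℝ} (hc : 0 ≤ c)
    (h1 : ∀ M : PerfectMatching X, M.1 u = v → h M ≤ 3 * c)
    (h2 : ∀ M : PerfectMatching X, M.1 u ≠ v → h M ≤ c * φ (M.1 u) (M.1 v))
    (hφ : ∑ x ∈ ((univ.erase u).erase v).offDiag, φ x.1 x.2 ≤
      ((Fintype.card X : ℝ) - 3) * ((Fintype.card X : ℝ) - 4)) :
    ∑ M, h M ≤ c * Fintype.card (PerfectMatching X) := by
  set O := (univ.erase u).erase v with hO
  set c₁ := #{M : PerfectMatching X | M.1 u = v} with hc₁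
  have hmemO : ∀ y, y ∈ O ↔ y ≠ u ∧ y ≠ v := fun y => by simp [hO, and_comm]
  have hOcard : #O = Fintype.card X - 2 := by
    rw [hO, Finset.card_erase_of_mem (by simp [huv.symm]), Finset.card_erase_of_mem (mem_univ u),
      Finset.card_univ]
    omega
  obtain ⟨y₀, hy₀, z₀, hz₀, hyz₀⟩ := Finset.one_lt_card.1 (show 1 < #O by omega)
  set c₂ := #{M : PerfectMatching X | M.1 u = y₀ ∧ M.1 v = z₀} with hc₂
  have htot := card_eq_mul_card_opp huv
  rw [← hc₁] at htot
  have hmaps : ∀ M ∈ ({M : PerfectMatching X | ¬ M.1 u = v} : Finset (PerfectMatching X)),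
      (M.1 u, M.1 v) ∈ O.offDiag := by
    intro M hM
    have hM' : M.1 u ≠ v := by simpa using hM
    rw [Finset.mem_offDiag, hmemO, hmemO]
    refine ⟨⟨(M.2 u).2, hM'⟩, ⟨fun h => hM' ?_, (M.2 v).2⟩, fun h => huv ?_⟩
    · change M.1 v = u at h
      rw [← h, (M.2 v).1]
    · have := congrArg M.1 h
      rwa [(M.2 u).1, (M.2 v).1] at this
  have hfib : ∀ x ∈ O.offDiag, #{M ∈ ({M : PerfectMatching X | ¬ M.1 u = v} :
      Finset (PerfectMatching X)) | (M.1 u, M.1 v) = x} = c₂ := by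
    rintro ⟨y, z⟩ hx
    rw [Finset.mem_offDiag] at hx
    obtain ⟨hy, hz, hyz⟩ := hx
    rw [hc₂, ← card_opp_opp_const hyz hyz₀ ((hmemO y).1 hy) ((hmemO z).1 hz) ((hmemO _).1 hy₀)
      ((hmemO _).1 hz₀), Finset.filter_filter]
    congr 1
    ext M
    simp only [Finset.mem_filter, mem_univ, true_and, Prod.mk.injEq]
    exact ⟨fun h => h.2, fun h => ⟨by rw [h.1]; exact ((hmemO y).1 hy).2, h⟩⟩
  have hsplit : (Fintype.card (PerfectMatching X) : ℝ) = c₁ +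
      ((Fintype.card X : ℝ) - 2) * ((Fintype.card X : ℝ) - 3) * c₂ := by
    have e1 : Fintype.card (PerfectMatching X) = c₁ + #{M : PerfectMatching X | ¬ M.1 u = v} := by
      rw [hc₁, ← Finset.card_univ]
      exact (Finset.card_filter_add_card_filter_not _).symm
    have e2 := Finset.card_eq_sum_card_fiberwise hmaps
    rw [Finset.sum_congr rfl hfib, Finset.sum_const, Finset.offDiag_card, smul_eq_mul] at e2
    rw [e1, e2, hOcard]
    have : Fintype.card X - 2 ≤ (Fintype.card X - 2) * (Fintype.card X - 2) := Nat.le_mul_self _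
    have h2 : 2 ≤ Fintype.card X := by omega
    push_cast [this, h2]
    ring
  have hsum : ∑ M, h M ≤ 3 * c * c₁ + c * c₂ * ∑ x ∈ O.offDiag, φ x.1 x.2 := by
    rw [← Finset.sum_filter_add_sum_filter_not univ (fun M : PerfectMatching X => M.1 u = v)]
    refine add_le_add ?_ ?_
    · refine (Finset.sum_le_card_nsmul _ _ (3 * c) fun M hM => h1 M (by simpa using hM)).trans ?_
      rw [nsmul_eq_mul, mul_comm]
    · refine (Finset.sum_le_sum fun M hM => h2 M (by simpa using hM)).trans ?_
      rw [← Finset.sum_fiberwise_of_maps_to hmaps, Finset.mul_sum]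
      refine (Finset.sum_congr rfl fun x hx => ?_).le
      have : ∀ M ∈ ({M ∈ ({M : PerfectMatching X | ¬ M.1 u = v} :
          Finset (PerfectMatching X)) | (M.1 u, M.1 v) = x} : Finset (PerfectMatching X)),
          c * φ (M.1 u) (M.1 v) = c * φ x.1 x.2 := by
        intro M hM
        rw [← (Finset.mem_filter.1 hM).2]
      rw [Finset.sum_congr rfl this, Finset.sum_const, hfib x hx, nsmul_eq_mul]
      ring
  have hN : (4 : ℝ) ≤ Fintype.card X := by exact_mod_cast hcard
  set N : ℝ := (Fintype.card X : ℝ)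
  have hc12 : (c₁ : ℝ) = (N - 3) * c₂ := by
    have h3 : (N - 2) * c₁ = (N - 2) * ((N - 3) * c₂) := by linarith
    exact mul_left_cancel₀ (by linarith) h3
  refine hsum.trans ?_
  have h4 : c * c₂ * ∑ x ∈ O.offDiag, φ x.1 x.2 ≤ c * c₂ * ((N - 3) * (N - 4)) :=
    mul_le_mul_of_nonneg_left hφ (by positivity)
  rw [htot]
  have h5 : c * c₂ * ((N - 3) * (N - 4)) = c * c₁ * (N - 4) := by rw [hc12]; ring
  linarith [h4, h5]

end PerfectMatching

/-! ### Exchanging one team for another -/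

namespace Tournament

open BernoulliProduct

variable {n : ℕ}

/-- The survivors of a round other than `u` and the opponent of `u`. -/
def otherSurvivors (D : Tournament n) (A : Finset (Fin n)) (M : PerfectMatching (Entrants A))
    (u : Fin n) : Finset (Fin n) :=
  (D.survivors A M).filter fun c =>
    c ≠ u ∧ ∀ (hc : c ∈ A) (hu : u ∈ A), M.1 (Sum.inl ⟨c, hc⟩) ≠ Sum.inl ⟨u, hu⟩

theorem mem_otherSurvivors (D : Tournament n) {A : Finset (Fin n)}
    (M : PerfectMatching (Entrants A)) {u : Fin n} (hu : u ∈ A) (c : Fin n) :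
    c ∈ D.otherSurvivors A M u ↔ c ≠ u ∧ ∃ hc : c ∈ A,
      M.1 (Sum.inl ⟨c, hc⟩) ≠ Sum.inl ⟨u, hu⟩ ∧
        D.winsAgainst c (M.1 (Sum.inl ⟨c, hc⟩)) = true := by
  rw [otherSurvivors, Finset.mem_filter, mem_survivors]
  constructor
  · rintro ⟨⟨hc, h1⟩, h2, h3⟩
    exact ⟨h2, hc, h3 hc hu, h1⟩
  · rintro ⟨h2, hc, h3, h1⟩
    exact ⟨⟨hc, h1⟩, h2, fun _ _ => h3⟩

theorem not_mem_otherSurvivors (D : Tournament n) (A : Finset (Fin n))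
    (M : PerfectMatching (Entrants A)) (u : Fin n) : u ∉ D.otherSurvivors A M u := by
  simp [otherSurvivors]

theorem otherSurvivors_subset (D : Tournament n) {A : Finset (Fin n)}
    (M : PerfectMatching (Entrants A)) {u : Fin n} (hu : u ∈ A) :
    D.otherSurvivors A M u ⊆ A := fun c hc =>
  let ⟨_, h, _⟩ := (mem_otherSurvivors D M hu c).1 hc
  h

theorem survivors_eq_insert (D : Tournament n) {A : Finset (Fin n)}
    (M : PerfectMatching (Entrants A)) {u : Fin n} (h : u ∈ D.survivors A M) :
    D.survivors A M = insert u (D.otherSurvivors A M u) := by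
  have hu := D.survivors_subset A M h
  ext c
  rw [Finset.mem_insert, mem_otherSurvivors D M hu]
  constructor
  · intro hc
    refine or_iff_not_imp_left.2 fun hcu => ⟨hcu, D.survivors_subset A M hc, fun hM => ?_,
      (mem_survivors_of_mem D M _).1 hc⟩
    rw [mem_survivors_of_mem D M (D.survivors_subset A M hc), hM] at hc
    rw [mem_survivors_of_mem D M hu, (opp_eq_iff M).1 hM] at h
    exact (beats_or hcu).1 h hc
  · rintro (rfl | ⟨_, hc, _, h1⟩)
    · exact h
    · exact (mem_survivors_of_mem D M hc).2 h1

theorem disjoint_passMatch {A : Finset (Fin n)} (M : PerfectMatching (Entrants A)) {u c : A}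
    (hcu : c ≠ u) (hM : M.1 (Sum.inl c) ≠ Sum.inl u) :
    Disjoint (passMatch u.1 (M.1 (Sum.inl u))) (passMatch c.1 (M.1 (Sum.inl c))) := by
  have hinj : Function.Injective M.1 := fun x y h => by
    rw [← opp_opp M x, h, opp_opp]
  rcases hb : M.1 (Sum.inl u) with b | d
  · rcases hc : M.1 (Sum.inl c) with b' | d'
    · have hbb : b ≠ b' := by
        rintro rfl
        exact hcu (Sum.inl_injective (hinj (hc.trans hb.symm)))
      have hbu : b' ≠ u := by
        rintro rfl
        exact hM hc
      refine disjoint_matchOf (Or.inl fun h => hcu (Subtype.ext h))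
        (Or.inr fun h => hbu (Subtype.ext h))
    · exact Set.disjoint_empty _
  · exact Set.empty_disjoint _

theorem dependsOn_otherSurvivors {A : Finset (Fin n)} (M : PerfectMatching (Entrants A)) (u : A) :
    DependsOn (fun ω : Match n → Bool => (ofOutcomes ω).otherSurvivors A M u)
      (passMatch u.1 (M.1 (Sum.inl u)))ᶜ := by
  intro ω ω' h
  ext c
  rw [mem_otherSurvivors _ M u.2, mem_otherSurvivors _ M u.2]
  refine and_congr_right fun hcu => exists_congr fun hc => and_congr_right fun hM => ?_
  have := dependsOn_winsAgainst (A := A) c (M.1 (Sum.inl ⟨c, hc⟩)) fun e he => h e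
    fun he' => Set.disjoint_left.1 (disjoint_passMatch M (c := ⟨c, hc⟩)
      (fun h => hcu (congrArg Subtype.val h)) hM) he' he
  simp only at this
  rw [this]

/-- After one round, team `u` has to have won its match and to win the bracket against the other
survivors; these two are independent. -/
theorem mean_winBracket_survivors (p q : Match n → ℝ) {A : Finset (Fin n)}
    (M : PerfectMatching (Entrants A)) (u : A) :
    mean p (fun ω => winBracket q ((ofOutcomes ω).survivors A M) u) =
      passProb p u.1 (M.1 (Sum.inl u)) *
        mean p fun ω => winBracket q (insert u.1 ((ofOutcomes ω).otherSurvivors A M u)) u := by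
  rw [← mean_winsAgainst, ← mean_mul disjoint_compl_right]
  · congr 1
    funext ω
    by_cases h : u.1 ∈ (ofOutcomes ω).survivors A M
    · rw [if_pos ((mem_survivors_of_mem _ M u.2).1 h), one_mul, survivors_eq_insert _ M h]
    · rw [if_neg fun h' => h ((mem_survivors_of_mem _ M u.2).2 h'), zero_mul,
        winBracket_eq_zero _ h]
  · intro ω ω' h
    have := dependsOn_winsAgainst u.1 (M.1 (Sum.inl u)) h
    simp only at this ⊢
    rw [this]
  · intro ω ω' h
    have := dependsOn_otherSurvivors M u h
    simp only at this ⊢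
    rw [this]

theorem winBracket_step_of_mem (p : Match n → ℝ) {A : Finset (Fin n)} (hA : 1 < #A) (u : A) :
    winBracket p A u = (∑ M : PerfectMatching (Entrants A), passProb p u.1 (M.1 (Sum.inl u)) *
      mean p fun ω => winBracket p (insert u.1 ((ofOutcomes ω).otherSurvivors A M u)) u) /
        Fintype.card (PerfectMatching (Entrants A)) := by
  rw [winBracket_step p hA]
  simp_rw [mean_winBracket_survivors]

theorem card_matchings_pos {A : Finset (Fin n)} (hA : 1 < #A) :
    (0 : ℝ) < Fintype.card (PerfectMatching (Entrants A)) := by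
  have := PerfectMatching.nonempty_of_even (even_card_entrants hA)
  exact_mod_cast Fintype.card_pos

/-- Someone else survives the round if `u` plays a dummy and is not alone. -/
theorem otherSurvivors_nonempty (D : Tournament n) {A : Finset (Fin n)} (hA : 1 < #A)
    (M : PerfectMatching (Entrants A)) (u : A) {d : Dummy A} (hd : M.1 (Sum.inl u) = Sum.inr d) :
    (D.otherSurvivors A M u).Nonempty := by
  obtain ⟨c, hc, hcu⟩ := Finset.exists_mem_ne hA u.1
  have hnot : ∀ b : A, M.1 (Sum.inl b) ≠ Sum.inl u := fun b h => by
    rw [opp_eq_iff, hd] at h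
    cases h
  by_cases hw : D.winsAgainst c (M.1 (Sum.inl ⟨c, hc⟩)) = true
  · exact ⟨c, (mem_otherSurvivors D M u.2 c).2 ⟨hcu, hc, hnot _, hw⟩⟩
  rcases hb : M.1 (Sum.inl ⟨c, hc⟩) with b | d'
  · rw [hb] at hw
    have hbc : b.1 ≠ c := fun h => opp_ne M (Sum.inl ⟨c, hc⟩) (by
      rw [hb]; exact congrArg Sum.inl (Subtype.ext h))
    refine ⟨b, (mem_otherSurvivors D M u.2 b).2 ⟨fun h => ?_, b.2, hnot _, ?_⟩⟩
    · exact hnot ⟨c, hc⟩ (by rw [hb]; exact congrArg Sum.inl (Subtype.ext h))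
    · have : M.1 (Sum.inl ⟨b.1, b.2⟩) = Sum.inl ⟨c, hc⟩ := (opp_eq_iff M).1 hb
      rw [this]
      exact (beats_or hbc.symm).2 hw
  · exact absurd (by rw [hb]; rfl) hw

/-- The other survivors are fewer than the other teams. -/
theorem card_otherSurvivors_lt (D : Tournament n) {A : Finset (Fin n)} (hA : 1 < #A)
    (M : PerfectMatching (Entrants A)) (u : A) : #(D.otherSurvivors A M u) + 1 < #A := by
  have hsub := otherSurvivors_subset D M u.2
  rcases hb : M.1 (Sum.inl u) with b | d
  · have hbu : b ≠ u := fun h => opp_ne M (Sum.inl u) (by rw [hb, h])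
    have h1 : D.otherSurvivors A M u ⊆ (A.erase u).erase b := by
      intro c hc
      rw [Finset.mem_erase, Finset.mem_erase]
      obtain ⟨hcu, hcA, h2, -⟩ := (mem_otherSurvivors D M u.2 c).1 hc
      refine ⟨?_, hcu, hcA⟩
      rintro rfl
      exact h2 ((opp_eq_iff M).1 hb)
    have h2 := Finset.card_le_card h1
    rw [Finset.card_erase_of_mem (Finset.mem_erase.2 ⟨fun h => hbu (Subtype.ext h), b.2⟩),
      Finset.card_erase_of_mem u.2] at h2
    omega
  · have hs : u.1 ∈ D.survivors A M := (mem_survivors_of_mem D M u.2).2 (by rw [hb]; rfl)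
    have h1 := D.card_survivors_lt hA M
    rwa [survivors_eq_insert D M hs,
      Finset.card_insert_of_notMem (not_mem_otherSurvivors D A M u)] at h1

/-- A team that has to win at least one more match wins the bracket with probability at most `a`, if
it wins each match with probability at most `a`. -/
theorem winBracket_le {p : Match n → ℝ} (hp : ∀ e, p e ∈ Set.Icc (0 : ℝ) 1) {a : ℝ} {u : Fin n}
    {A : Finset (Fin n)} (ha : ∀ w ∈ A, w ≠ u → beatProb p u w ≤ a) (hu : u ∈ A) (hA : 1 < #A) :
    winBracket p A u ≤ a := by
  induction hk : #A using Nat.strong_induction_on generalizing A with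
  | _ k ih =>
    subst hk
    rw [winBracket_step_of_mem p hA ⟨u, hu⟩, div_le_iff₀ (card_matchings_pos hA), mul_comm,
      ← nsmul_eq_mul]
    refine Finset.sum_le_card_nsmul _ _ _ fun M _ => ?_
    have h01 := passProb_mem hp u (M.1 (Sum.inl ⟨u, hu⟩))
    rcases hb : M.1 (Sum.inl ⟨u, hu⟩) with b | d
    · have hbu : b.1 ≠ u := fun h => opp_ne M (Sum.inl ⟨u, hu⟩) (by
        rw [hb]; exact congrArg Sum.inl (Subtype.ext h))
      rw [hb] at h01
      calc _ ≤ passProb p u (Sum.inl b : Entrants A) * 1 :=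
            mul_le_mul_of_nonneg_left (mean_le hp fun _ => winBracket_le_one hp _ _) h01.1
        _ ≤ a := by rw [mul_one]; exact ha b b.2 hbu
    · change 1 * _ ≤ a
      rw [one_mul]
      refine mean_le hp fun ω => ?_
      have hnot := not_mem_otherSurvivors (ofOutcomes ω) A M u
      have hne := otherSurvivors_nonempty (ofOutcomes ω) hA M ⟨u, hu⟩ hb
      have hcard := Finset.card_insert_of_notMem hnot
      have hlt := card_otherSurvivors_lt (ofOutcomes ω) hA M ⟨u, hu⟩
      have hpos := hne.card_pos
      simp only at hlt hpos
      refine ih _ (by rw [hcard]; exact hlt) (fun w hw => ha w ?_) (Finset.mem_insert_self _ _)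
        (by rw [hcard]; omega) rfl
      rcases Finset.mem_insert.1 hw with rfl | hw
      · exact hu
      · exact otherSurvivors_subset (ofOutcomes ω) M hu hw

/-- The bijection from `C ∪ {u}` to `C ∪ {v}` that replaces `u` by `v`. -/
def exchange {C : Finset (Fin n)} {u v : Fin n} (hu : u ∉ C) (hv : v ∉ C) :
    {x // x ∈ insert u C} ≃ {x // x ∈ insert v C} where
  toFun x := if h : x.1 = u then ⟨v, Finset.mem_insert_self _ _⟩ else
    ⟨x.1, Finset.mem_insert_of_mem (Finset.mem_of_mem_insert_of_ne x.2 h)⟩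
  invFun x := if h : x.1 = v then ⟨u, Finset.mem_insert_self _ _⟩ else
    ⟨x.1, Finset.mem_insert_of_mem (Finset.mem_of_mem_insert_of_ne x.2 h)⟩
  left_inv x := by
    by_cases h : x.1 = u
    · simp only [h, dif_pos]
      exact Subtype.ext h.symm
    · have h2 : x.1 ≠ v := fun h' => hv (h' ▸ Finset.mem_of_mem_insert_of_ne x.2 h)
      simp [h, h2]
  right_inv x := by
    by_cases h : x.1 = v
    · simp only [h, dif_pos]
      exact Subtype.ext h.symm
    · have h2 : x.1 ≠ u := fun h' => hu (h' ▸ Finset.mem_of_mem_insert_of_ne x.2 h)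
      simp [h, h2]

theorem card_dummies_eq {C : Finset (Fin n)} {u v : Fin n} (hu : u ∉ C) (hv : v ∉ C) :
    2 ^ Nat.clog 2 #(insert u C) - #(insert u C) =
      2 ^ Nat.clog 2 #(insert v C) - #(insert v C) := by
  rw [Finset.card_insert_of_notMem hu, Finset.card_insert_of_notMem hv]

/-- The bijection of entrants that replaces `u` by `v`. -/
def exchangeEntrants {C : Finset (Fin n)} {u v : Fin n} (hu : u ∉ C) (hv : v ∉ C) :
    Entrants (insert u C) ≃ Entrants (insert v C) :=
  Equiv.sumCongr (exchange hu hv) (finCongr (card_dummies_eq hu hv))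

section Exchange

variable {C : Finset (Fin n)} {u v : Fin n}

theorem exchangeEntrants_self (hu : u ∉ C) (hv : v ∉ C) :
    exchangeEntrants hu hv (Sum.inl ⟨u, Finset.mem_insert_self _ _⟩) =
    Sum.inl ⟨v, Finset.mem_insert_self _ _⟩ := by
  simp [exchangeEntrants, exchange]

theorem exchangeEntrants_of_mem (hu : u ∉ C) (hv : v ∉ C) {c : Fin n} (hc : c ∈ C) :
    exchangeEntrants hu hv (Sum.inl ⟨c, Finset.mem_insert_of_mem hc⟩) =
      Sum.inl ⟨c, Finset.mem_insert_of_mem hc⟩ := by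
  have : c ≠ u := fun h => hu (h ▸ hc)
  simp [exchangeEntrants, exchange, this]

theorem winsAgainst_exchange (hu : u ∉ C) (hv : v ∉ C) (D : Tournament n) (c : Fin n)
    {x : Entrants (insert u C)}
    (hx : x ≠ Sum.inl ⟨u, Finset.mem_insert_self _ _⟩) :
    D.winsAgainst c (exchangeEntrants hu hv x) = D.winsAgainst c x := by
  rcases x with b | d
  · have hb : b.1 ∈ C := Finset.mem_of_mem_insert_of_ne b.2 fun h =>
      hx (congrArg Sum.inl (Subtype.ext h))
    exact congrArg (D.winsAgainst c) (exchangeEntrants_of_mem hu hv hb)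
  · rfl

theorem passProb_exchange (hu : u ∉ C) (hv : v ∉ C) (p : Match n → ℝ) (c : Fin n)
    {x : Entrants (insert u C)}
    (hx : x ≠ Sum.inl ⟨u, Finset.mem_insert_self _ _⟩) :
    passProb p c (exchangeEntrants hu hv x) = passProb p c x := by
  rcases x with b | d
  · have hb : b.1 ∈ C := Finset.mem_of_mem_insert_of_ne b.2 fun h =>
      hx (congrArg Sum.inl (Subtype.ext h))
    exact congrArg (passProb p c) (exchangeEntrants_of_mem hu hv hb)
  · rfl

theorem mem_otherSurvivors_insert (hu : u ∉ C) (D : Tournament n)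
    (M : PerfectMatching (Entrants (insert u C))) (c : Fin n) :
    c ∈ D.otherSurvivors (insert u C) M u ↔ ∃ hc : c ∈ C,
      M.1 (Sum.inl ⟨c, Finset.mem_insert_of_mem hc⟩) ≠
        Sum.inl ⟨u, Finset.mem_insert_self _ _⟩ ∧
      D.winsAgainst c (M.1 (Sum.inl ⟨c, Finset.mem_insert_of_mem hc⟩)) = true := by
  rw [mem_otherSurvivors D M (Finset.mem_insert_self _ _)]
  constructor
  · rintro ⟨h1, h2, h3⟩
    exact ⟨Finset.mem_of_mem_insert_of_ne h2 h1, h3⟩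
  · rintro ⟨h1, h3⟩
    exact ⟨fun h => hu (h ▸ h1), Finset.mem_insert_of_mem h1, h3⟩

/-- The other survivors of a round do not notice that `u` is replaced by `v`. -/
theorem otherSurvivors_exchange (hu : u ∉ C) (hv : v ∉ C) (D : Tournament n)
    (M : PerfectMatching (Entrants (insert u C))) :
    D.otherSurvivors (insert v C) (PerfectMatching.relabel (exchangeEntrants hu hv) M) v =
      D.otherSurvivors (insert u C) M u := by
  ext c
  rw [mem_otherSurvivors_insert hv, mem_otherSurvivors_insert hu]
  refine exists_congr fun hc => ?_
  rw [← exchangeEntrants_of_mem hu hv hc, PerfectMatching.relabel_apply,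
    ← exchangeEntrants_self hu hv, (exchangeEntrants hu hv).injective.ne_iff]
  exact and_congr_right fun h => by rw [winsAgainst_exchange hu hv D c h]

theorem winBracket_sub_step (hu : u ∉ C) (hv : v ∉ C) (p : Match n → ℝ) (hC : C.Nonempty) :
    winBracket p (insert u C) u - winBracket p (insert v C) v =
      (∑ M : PerfectMatching (Entrants (insert u C)), mean p fun ω =>
        (passProb p u (M.1 (Sum.inl ⟨u, Finset.mem_insert_self _ _⟩)) *
            winBracket p (insert u ((ofOutcomes ω).otherSurvivors (insert u C) M u)) u -
          passProb p v (M.1 (Sum.inl ⟨u, Finset.mem_insert_self _ _⟩)) *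
            winBracket p (insert v ((ofOutcomes ω).otherSurvivors (insert u C) M u)) v)) /
        Fintype.card (PerfectMatching (Entrants (insert u C))) := by
  have h1 : 1 < #(insert u C) := by
    rw [Finset.card_insert_of_notMem hu]
    have := hC.card_pos
    omega
  have h2 : 1 < #(insert v C) := by
    rw [Finset.card_insert_of_notMem hv]
    have := hC.card_pos
    omega
  have e := PerfectMatching.relabel (exchangeEntrants hu hv)
  rw [winBracket_step_of_mem p h1 ⟨u, Finset.mem_insert_self _ _⟩,
    winBracket_step_of_mem p h2 ⟨v, Finset.mem_insert_self _ _⟩, ← Fintype.card_congr e, ← sub_div,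
    ← Equiv.sum_comp (PerfectMatching.relabel (exchangeEntrants hu hv)), ← Finset.sum_sub_distrib]
  congr 1
  refine Finset.sum_congr rfl fun M _ => ?_
  rw [mean_sub, mean_mul_left, mean_mul_left]
  simp_rw [otherSurvivors_exchange hu hv]
  rw [← exchangeEntrants_self hu hv, PerfectMatching.relabel_apply,
    passProb_exchange hu hv p v (opp_ne M _)]

/-- What `u` gains over `v` in the same position of a bracket: at most the largest difference
`a - b` between the win probabilities of a single match, and nothing if `u` is nowhere
better than `v`. -/
theorem winBracket_sub_le {p : Match n → ℝ} (hp : ∀ e, p e ∈ Set.Icc (0 : ℝ) 1) {a b : ℝ}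
    (hb : 0 ≤ b) (hba : b ≤ a) (hab : a + b = 1) (hu : u ∉ C) (hv : v ∉ C)
    (hpu : ∀ w ∈ C, beatProb p u w ≤ a) (hpv : ∀ w ∈ C, b ≤ beatProb p v w) :
    winBracket p (insert u C) u - winBracket p (insert v C) v ≤ a - b ∧
      ((∀ w ∈ C, beatProb p u w ≤ beatProb p v w) →
        winBracket p (insert u C) u - winBracket p (insert v C) v ≤ 0) := by
  induction hk : #C using Nat.strong_induction_on generalizing C with
  | _ k ih =>
    subst hk
    rcases C.eq_empty_or_nonempty with rfl | hC
    · simp only [insert_empty_eq, winBracket_singleton, sub_self]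
      exact ⟨by linarith, fun _ => le_rfl⟩
    have huA : u ∈ insert u C := Finset.mem_insert_self _ _
    have hcardA := Finset.card_insert_of_notMem hu
    have hA : 1 < #(insert u C) := by
      rw [hcardA]
      have := hC.card_pos
      omega
    have hpos := card_matchings_pos hA
    have hsub : ∀ (M : PerfectMatching (Entrants (insert u C))) (ω : Match n → Bool),
        (ofOutcomes ω).otherSurvivors (insert u C) M u ⊆ C := fun M ω c hc =>
      let ⟨h, _⟩ := (mem_otherSurvivors_insert hu _ M c).1 hc
      h
    have hlt : ∀ (M : PerfectMatching (Entrants (insert u C))) (ω : Match n → Bool),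
        #((ofOutcomes ω).otherSurvivors (insert u C) M u) < #C := fun M ω => by
      have := card_otherSurvivors_lt (ofOutcomes ω) hA M ⟨u, huA⟩
      simp only at this
      omega
    have IH := fun M ω => ih _ (hlt M ω) (fun h => hu (hsub M ω h)) (fun h => hv (hsub M ω h))
      (fun w hw => hpu w (hsub M ω hw)) (fun w hw => hpv w (hsub M ω hw)) rfl
    rw [winBracket_sub_step hu hv p hC]
    refine ⟨?_, fun hle => ?_⟩
    · rw [div_le_iff₀ hpos, mul_comm, ← nsmul_eq_mul]
      refine Finset.sum_le_card_nsmul _ _ _ fun M _ => mean_le hp fun ω => ?_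
      obtain ⟨hF, -⟩ := IH M ω
      set R := (ofOutcomes ω).otherSurvivors (insert u C) M u with hR
      rcases hx : M.1 (Sum.inl ⟨u, huA⟩) with w | d
      · have hwu : w.1 ≠ u := fun h => opp_ne M (Sum.inl ⟨u, huA⟩) (by
          rw [hx]; exact congrArg Sum.inl (Subtype.ext h))
        have hwC : w.1 ∈ C := Finset.mem_of_mem_insert_of_ne w.2 hwu
        change beatProb p u w * _ - beatProb p v w * _ ≤ _
        have hF0 := winBracket_nonneg hp (insert u R) u
        have hG0 := winBracket_nonneg hp (insert v R) v
        have h1 := mul_le_mul_of_nonneg_right (hpu w hwC) hF0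
        have h2 := mul_le_mul_of_nonneg_right (hpv w hwC) hG0
        rcases R.eq_empty_or_nonempty with hR0 | hR1
        · rw [hR0] at h1 h2 ⊢
          simp only [insert_empty_eq, winBracket_singleton] at h1 h2 ⊢
          linarith
        · -- here `u` has a match left after this one, so it wins with probability at most `a`
          have huR : u ∉ R := fun h => hu (hsub M ω h)
          have hFa : winBracket p (insert u R) u ≤ a := by
            refine winBracket_le hp (fun w hw hwu => hpu w (hsub M ω ?_))
              (Finset.mem_insert_self _ _) ?_
            · exact Finset.mem_of_mem_insert_of_ne hw hwu
            · rw [Finset.card_insert_of_notMem huR]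
              have := hR1.card_pos
              omega
          set F := winBracket p (insert u R) u
          set G := winBracket p (insert v R) v
          have h3 : b * (F - G) ≤ b * (a - b) := mul_le_mul_of_nonneg_left hF hb
          have h4 : (a - b) * F ≤ (a - b) * a := mul_le_mul_of_nonneg_left hFa (by linarith)
          have h5 : (a - b) * a + b * (a - b) = a - b := by
            calc _ = (a - b) * (a + b) := by ring
              _ = a - b := by rw [hab, mul_one]
          linarith
      · change 1 * _ - 1 * _ ≤ _
        rw [one_mul, one_mul]
        exact hF
    · refine div_nonpos_of_nonpos_of_nonneg (Finset.sum_nonpos fun M _ => mean_le hp fun ω => ?_)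
        hpos.le
      obtain ⟨-, hF⟩ := IH M ω
      have hF := hF fun w hw => hle w (hsub M ω hw)
      set R := (ofOutcomes ω).otherSurvivors (insert u C) M u with hR
      rcases hx : M.1 (Sum.inl ⟨u, huA⟩) with w | d
      · have hwu : w.1 ≠ u := fun h => opp_ne M (Sum.inl ⟨u, huA⟩) (by
          rw [hx]; exact congrArg Sum.inl (Subtype.ext h))
        have hwC : w.1 ∈ C := Finset.mem_of_mem_insert_of_ne w.2 hwu
        change beatProb p u w * _ - beatProb p v w * _ ≤ _
        have h1 := mul_le_mul_of_nonneg_right (hle w hwC) (winBracket_nonneg hp (insert u R) u)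
        have h2 := mul_le_mul_of_nonneg_left (sub_nonpos.1 hF) (beatProb_mem hp v w).1
        linarith
      · change 1 * _ - 1 * _ ≤ _
        rw [one_mul, one_mul]
        exact hF

end Exchange

end Tournament

/-! ### The gain of a coalition of two teams -/

namespace Tournament

open BernoulliProduct

theorem sum_offDiag_mul {X : Type*} [DecidableEq X] (O : Finset X) (U V : X → ℝ) :
    ∑ x ∈ O.offDiag, U x.1 * V x.2 = (∑ x ∈ O, U x) * (∑ x ∈ O, V x) - ∑ x ∈ O, U x * V x := by
  rw [Finset.sum_mul_sum, ← Finset.sum_product', ← Finset.diag_union_offDiag,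
    Finset.sum_union (Finset.disjoint_diag_offDiag O), Finset.sum_diag]
  ring

/-- If `u` and `v` have two opponents `x₁`, `x₂` which `v` beats with probability at most `b`, and a
third one, `x₃`, then they are likely enough to lose in the next round. -/
theorem sum_offDiag_mul_le {X : Type*} [DecidableEq X] {O : Finset X} {U V : X → ℝ}
    (hU : ∀ x ∈ O, U x ∈ Set.Icc (0 : ℝ) 1) (hV : ∀ x ∈ O, V x ∈ Set.Icc (0 : ℝ) 1) {a b : ℝ}
    (hb : 0 ≤ b) (hba : b ≤ a) (hab : a + b = 1) {x₁ x₂ x₃ : X} (h₁ : x₁ ∈ O) (h₂ : x₂ ∈ O)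
    (h₃ : x₃ ∈ O) (h₁₂ : x₁ ≠ x₂) (h₁₃ : x₁ ≠ x₃) (h₂₃ : x₂ ≠ x₃) (hU₁ : U x₁ ≤ a) (hU₂ : U x₂ ≤ a)
    (hU₃ : U x₃ ≤ a) (hV₁ : V x₁ ≤ b) (hV₂ : V x₂ ≤ b) (hV₃ : V x₃ ≤ a) :
    ∑ x ∈ O.offDiag, U x.1 * V x.2 ≤ ((#O : ℝ) - 1) * ((#O : ℝ) - 2) := by
  obtain rfl : a = 1 - b := by linarith
  let δ : X → X → ℝ := fun y x => if x = y then 1 else 0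
  have hδ : ∀ y ∈ O, ∑ x ∈ O, δ y x = 1 := fun y hy => by simp [δ, hy]
  let U' : X → ℝ := fun x => 1 - b * δ x₁ x - b * δ x₂ x - b * δ x₃ x
  let V' : X → ℝ := fun x => 1 - (1 - b) * δ x₁ x - (1 - b) * δ x₂ x - b * δ x₃ x
  have hUU' : ∀ x ∈ O, U x ≤ U' x := by
    intro x hx
    by_cases e₁ : x = x₁
    · subst e₁; simpa [U', δ, h₁₂, h₁₃] using hU₁
    by_cases e₂ : x = x₂
    · subst e₂; simpa [U', δ, h₁₂.symm, h₂₃] using hU₂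
    by_cases e₃ : x = x₃
    · subst e₃; simpa [U', δ, h₁₃.symm, h₂₃.symm] using hU₃
    simpa [U', δ, e₁, e₂, e₃] using (hU x hx).2
  have hVV' : ∀ x ∈ O, V x ≤ V' x := by
    intro x hx
    by_cases e₁ : x = x₁
    · subst e₁; simpa [V', δ, h₁₂, h₁₃] using hV₁
    by_cases e₂ : x = x₂
    · subst e₂; simpa [V', δ, h₁₂.symm, h₂₃] using hV₂
    by_cases e₃ : x = x₃
    · subst e₃; simpa [V', δ, h₁₃.symm, h₂₃.symm] using hV₃
    simpa [V', δ, e₁, e₂, e₃] using (hV x hx).2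
  have hle : ∑ x ∈ O.offDiag, U x.1 * V x.2 ≤ ∑ x ∈ O.offDiag, U' x.1 * V' x.2 := by
    refine Finset.sum_le_sum fun x hx => ?_
    rw [Finset.mem_offDiag] at hx
    exact mul_le_mul (hUU' _ hx.1) (hVV' _ hx.2.1) (hV _ hx.2.1).1
      ((hU _ hx.1).1.trans (hUU' _ hx.1))
  have hdiag : ∀ x, U' x * V' x = 1 - (1 - (1 - b) * b) * δ x₁ x - (1 - (1 - b) * b) * δ x₂ x -
      (1 - (1 - b) * (1 - b)) * δ x₃ x := by
    intro x
    by_cases e₁ : x = x₁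
    · subst e₁; simp [U', V', δ, h₁₂, h₁₃]
    by_cases e₂ : x = x₂
    · subst e₂; simp [U', V', δ, h₁₂.symm, h₂₃]
    by_cases e₃ : x = x₃
    · subst e₃; simp [U', V', δ, h₁₃.symm, h₂₃.symm]
    simp [U', V', δ, e₁, e₂, e₃]
  have hcard : (3 : ℝ) ≤ #O := by
    have h := Finset.card_le_card (show ({x₁, x₂, x₃} : Finset X) ⊆ O by
      intro x hx
      simp only [Finset.mem_insert, Finset.mem_singleton] at hx
      rcases hx with rfl | rfl | rfl <;> assumption)
    rw [Finset.card_eq_three.2 ⟨x₁, x₂, x₃, h₁₂, h₁₃, h₂₃, rfl⟩] at h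
    exact_mod_cast h
  refine hle.trans ?_
  rw [sum_offDiag_mul, Finset.sum_congr rfl fun x _ => hdiag x]
  simp only [U', V', Finset.sum_sub_distrib, ← Finset.mul_sum, hδ _ h₁, hδ _ h₂, hδ _ h₃,
    Finset.sum_const, nsmul_eq_mul, mul_one]
  have h4 : b * 3 ≤ b * #O := mul_le_mul_of_nonneg_left hcard hb
  nlinarith [mul_nonneg hb hb]

variable {n : ℕ}

theorem card_entrants {A : Finset (Fin n)} :
    Fintype.card (Entrants A) = 2 ^ Nat.clog 2 #A := by
  have h1 : #A ≤ 2 ^ Nat.clog 2 #A := Nat.le_pow_clog (by norm_num) _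
  simp only [Fintype.card_sum, Fintype.card_coe, Fintype.card_fin]
  omega

/-- The gain in winning probability of the coalition `{u, v}` in the bracket from `A`, when the
match probabilities change from `q` to `p`. -/
noncomputable def pairGain (p q : Match n → ℝ) (u v : Fin n) (A : Finset (Fin n)) : ℝ :=
  winBracket p A u + winBracket p A v - (winBracket q A u + winBracket q A v)

/-- The teams of `A` against which `u` has better chances than `v`. -/
noncomputable def threats (p : Match n → ℝ) (u v : Fin n) (A : Finset (Fin n)) : Finset (Fin n) :=
  {w ∈ A | w ≠ u ∧ w ≠ v ∧ beatProb p v w < beatProb p u w}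

theorem pairGain_eq_zero {p q : Match n → ℝ} {u v : Fin n} {A : Finset (Fin n)}
    (hpq : ∀ e ∉ matchOf u v, p e = q e) (h : ¬ (u ∈ A ∧ v ∈ A)) : pairGain p q u v A = 0 := by
  have : ∀ e ∈ matchesIn A, p e = q e := by
    rintro e ⟨h1, h2⟩
    refine hpq e ?_
    rintro (⟨rfl, rfl⟩ | ⟨rfl, rfl⟩)
    · exact h ⟨h1, h2⟩
    · exact h ⟨h2, h1⟩
  rw [pairGain, winBracket_congr this, winBracket_congr this, sub_self]

section Round

variable {p q : Match n → ℝ} {a b : ℝ} {u v : Fin n} {A : Finset (Fin n)}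

/-- If `u` and `v` play each other, the coalition gains what `u` does better than `v` in the later
rounds. -/
theorem round_gain_of_opp (hpq : ∀ e ∉ matchOf u v, p e = q e) (huv : u ≠ v)
    (hp1 : beatProb p u v = 1) (hq0 : beatProb q u v = 0) (hu : u ∈ A) (hv : v ∈ A)
    {M : PerfectMatching (Entrants A)} (hM : M.1 (Sum.inl ⟨u, hu⟩) = Sum.inl ⟨v, hv⟩) :
    mean p (fun ω => winBracket p ((ofOutcomes ω).survivors A M) u) +
        mean p (fun ω => winBracket p ((ofOutcomes ω).survivors A M) v) -
      (mean q (fun ω => winBracket q ((ofOutcomes ω).survivors A M) u) +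
        mean q (fun ω => winBracket q ((ofOutcomes ω).survivors A M) v)) =
    mean p fun ω => winBracket p (insert u ((ofOutcomes ω).otherSurvivors A M u)) u -
      winBracket p (insert v ((ofOutcomes ω).otherSurvivors A M u)) v := by
  have hM' := (opp_eq_iff M).1 hM
  have hp0 : beatProb p v u = 0 := by linarith [beatProb_add (p := p) huv]
  have hq1 : beatProb q v u = 1 := by linarith [beatProb_add (p := q) huv]
  have hR : ∀ D : Tournament n, D.otherSurvivors A M v = D.otherSurvivors A M u := by
    intro D
    ext c
    rw [mem_otherSurvivors D M hv, mem_otherSurvivors D M hu]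
    have key : ∀ hc : c ∈ A, (c ≠ v ↔ M.1 (Sum.inl ⟨c, hc⟩) ≠ Sum.inl ⟨u, hu⟩) ∧
        (c ≠ u ↔ M.1 (Sum.inl ⟨c, hc⟩) ≠ Sum.inl ⟨v, hv⟩) := by
      intro hc
      rw [Ne, Ne, Ne, Ne, opp_eq_iff, hM, opp_eq_iff, hM']
      simp [eq_comm]
    constructor
    · rintro ⟨h1, hc, h2, h3⟩
      exact ⟨(key hc).2.2 h2, hc, (key hc).1.1 h1, h3⟩
    · rintro ⟨h1, hc, h2, h3⟩
      exact ⟨(key hc).1.2 h2, hc, (key hc).2.1 h1, h3⟩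
  have e1 := mean_winBracket_survivors p p M ⟨u, hu⟩
  have e2 := mean_winBracket_survivors p p M ⟨v, hv⟩
  have e3 := mean_winBracket_survivors q q M ⟨u, hu⟩
  have e4 := mean_winBracket_survivors q q M ⟨v, hv⟩
  simp only [hM, hM', passProb, hp1, hp0, hq1, hq0, zero_mul, one_mul, hR] at e1 e2 e3 e4
  rw [e1, e2, e3, e4, mean_sub, add_zero, zero_add]
  refine congrArg (_ - ·) ?_
  have e5 : ∀ ω : Match n → Bool,
      winBracket q (insert v ((ofOutcomes ω).otherSurvivors A M u)) v =
        winBracket p (insert v ((ofOutcomes ω).otherSurvivors A M u)) v := by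
    intro ω
    refine winBracket_congr (fun e he => (hpq e fun he' => ?_).symm) v
    have hnot : u ∉ insert v ((ofOutcomes ω).otherSurvivors A M u) := by
      rw [Finset.mem_insert]
      rintro (h | h)
      · exact huv h
      · exact not_mem_otherSurvivors _ A M u h
    rcases he' with ⟨rfl, -⟩ | ⟨-, rfl⟩
    · exact hnot he.1
    · exact hnot he.2
  simp_rw [e5]
  refine mean_congr (s := (matchOf u v)ᶜ) (fun e he => (hpq e he).symm) fun ω ω' h => ?_
  have := dependsOn_otherSurvivors M ⟨u, hu⟩
  rw [hM] at this
  have := this h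
  simp only at this ⊢
  rw [this]

/-- If `u` and `v` do not play each other, the match between them is open in the later rounds. -/
theorem round_gain_of_not_opp (hpq : ∀ e ∉ matchOf u v, p e = q e) (hu : u ∈ A) (hv : v ∈ A)
    {M : PerfectMatching (Entrants A)} (hM : M.1 (Sum.inl ⟨u, hu⟩) ≠ Sum.inl ⟨v, hv⟩) :
    mean p (fun ω => winBracket p ((ofOutcomes ω).survivors A M) u) +
        mean p (fun ω => winBracket p ((ofOutcomes ω).survivors A M) v) -
      (mean q (fun ω => winBracket q ((ofOutcomes ω).survivors A M) u) +
        mean q (fun ω => winBracket q ((ofOutcomes ω).survivors A M) v)) =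
    mean p fun ω => pairGain p q u v ((ofOutcomes ω).survivors A M) := by
  have h : ∀ e ∈ roundMatches A M, q e = p e := by
    rintro e ⟨h1, h2, h3⟩
    refine (hpq e ?_).symm
    rintro (⟨rfl, rfl⟩ | ⟨rfl, rfl⟩)
    · exact hM h3
    · exact hM ((opp_eq_iff M).1 h3)
  have hdep : ∀ w, DependsOn (fun ω : Match n → Bool =>
      winBracket q ((ofOutcomes ω).survivors A M) w) (roundMatches A M) := by
    intro w ω ω' h
    have := dependsOn_survivors M h
    simp only at this ⊢
    rw [this]
  simp only [pairGain]
  rw [mean_sub, mean_add, mean_add, mean_congr h (hdep u), mean_congr h (hdep v)]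

/-- The probability that `u` and `v` both survive a round in which they do not meet. -/
theorem mean_both_survive (p : Match n → ℝ) (huv : u ≠ v) (hu : u ∈ A) (hv : v ∈ A)
    {M : PerfectMatching (Entrants A)} (hM : M.1 (Sum.inl ⟨u, hu⟩) ≠ Sum.inl ⟨v, hv⟩) :
    mean p (fun ω => if u ∈ (ofOutcomes ω).survivors A M ∧ v ∈ (ofOutcomes ω).survivors A M
        then 1 else 0) =
      passProb p u (M.1 (Sum.inl ⟨u, hu⟩)) * passProb p v (M.1 (Sum.inl ⟨v, hv⟩)) := by
  rw [← mean_winsAgainst, ← mean_winsAgainst, ← mean_mul (s := passMatch u (M.1 (Sum.inl ⟨u, hu⟩)))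
    (t := passMatch v (M.1 (Sum.inl ⟨v, hv⟩)))]
  · congr 1
    funext ω
    simp only [mem_survivors_of_mem _ M hu, mem_survivors_of_mem _ M hv, ite_and, mul_ite, mul_one,
      mul_zero]
    split_ifs <;> rfl
  · refine disjoint_passMatch M (u := ⟨u, hu⟩) (c := ⟨v, hv⟩)
      (fun h => huv (congrArg Subtype.val h).symm) fun h => hM ((opp_eq_iff M).1 h)
  · intro ω ω' h
    have := dependsOn_winsAgainst u _ h
    simp only at this ⊢
    rw [this]
  · intro ω ω' h
    have := dependsOn_winsAgainst v _ h
    simp only at this ⊢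
    rw [this]

theorem pairGain_step (p q : Match n → ℝ) (u v : Fin n) (hA : 1 < #A) :
    pairGain p q u v A = (∑ M : PerfectMatching (Entrants A),
      (mean p (fun ω => winBracket p ((ofOutcomes ω).survivors A M) u) +
        mean p (fun ω => winBracket p ((ofOutcomes ω).survivors A M) v) -
      (mean q (fun ω => winBracket q ((ofOutcomes ω).survivors A M) u) +
        mean q (fun ω => winBracket q ((ofOutcomes ω).survivors A M) v)))) /
      Fintype.card (PerfectMatching (Entrants A)) := by
  rw [pairGain, winBracket_step p hA, winBracket_step p hA, winBracket_step q hA,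
    winBracket_step q hA, Finset.sum_sub_distrib, Finset.sum_add_distrib, Finset.sum_add_distrib]
  ring

end Round

end Tournament

namespace Tournament

open BernoulliProduct

variable {n : ℕ}

section Opponents

variable {p : Match n → ℝ} {a b : ℝ} {u v : Fin n} {A : Finset (Fin n)}

open Classical in
/-- The probability that `u` and `v` both survive a round in which they play `y` and `z`, counted
only if some threat is left after `y` and `z` are eliminated. -/
noncomputable def surviveBound (p : Match n → ℝ) (u v : Fin n) {A : Finset (Fin n)}
    (y z : Entrants A) : ℝ :=
  if ∃ x : A, x.1 ∈ threats p u v A ∧ Sum.inl x ≠ y ∧ Sum.inl x ≠ z then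
    passProb p u y * passProb p v z else 0

theorem surviveBound_le (hp : ∀ e, p e ∈ Set.Icc (0 : ℝ) 1) (y z : Entrants A) :
    surviveBound p u v y z ≤ passProb p u y * passProb p v z := by
  unfold surviveBound
  split_ifs
  · exact le_rfl
  · exact mul_nonneg (passProb_mem hp u y).1 (passProb_mem hp v z).1

theorem surviveBound_le_one (hp : ∀ e, p e ∈ Set.Icc (0 : ℝ) 1) (y z : Entrants A) :
    surviveBound p u v y z ≤ 1 :=
  (surviveBound_le hp y z).trans
    (mul_le_one₀ (passProb_mem hp u y).2 (passProb_mem hp v z).1 (passProb_mem hp v z).2)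

/-- The number of pairs of distinct opponents of `u` and `v` that leave both of them and some threat
in the bracket is, in expectation, at most `(K - 1) * (K - 2)` for `K` entrants other than `u` and
`v`. -/
theorem sum_surviveBound_le (hp : ∀ e, p e ∈ Set.Icc (0 : ℝ) 1) (hb : 0 ≤ b) (hba : b ≤ a)
    (hab : a + b = 1) (huv : u ≠ v) (hu : u ∈ A) (hv : v ∈ A)
    (hpu : ∀ w, w ≠ u → w ≠ v → beatProb p u w ≤ a)
    (hpv : ∀ w, w ≠ u → w ≠ v → beatProb p v w ≤ a)
    (hth : ∀ w ∈ threats p u v A, beatProb p v w ≤ b) (hne : (threats p u v A).Nonempty)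
    (hcard : 4 ≤ Fintype.card (Entrants A)) :
    ∑ x ∈ ((univ.erase (Sum.inl ⟨u, hu⟩ : Entrants A)).erase (Sum.inl ⟨v, hv⟩)).offDiag,
        surviveBound p u v x.1 x.2 ≤
      ((Fintype.card (Entrants A) : ℝ) - 3) * ((Fintype.card (Entrants A) : ℝ) - 4) := by
  set O := (univ.erase (Sum.inl ⟨u, hu⟩ : Entrants A)).erase (Sum.inl ⟨v, hv⟩) with hO
  have hOcard : #O + 2 = Fintype.card (Entrants A) := by
    rw [hO, Finset.card_erase_of_mem, Finset.card_erase_of_mem (mem_univ _), Finset.card_univ]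
    · change Fintype.card (Entrants A) - 1 - 1 + 2 = Fintype.card (Entrants A)
      omega
    · simpa using huv.symm
  have hOr : (Fintype.card (Entrants A) : ℝ) = #O + 2 := by exact_mod_cast hOcard.symm
  have hmemO : ∀ x : A, x.1 ≠ u → x.1 ≠ v → Sum.inl x ∈ O := by
    intro x h1 h2
    simp [hO, Subtype.ext_iff, h1, h2]
  have hthmem : ∀ x : A, x.1 ∈ threats p u v A → x.1 ≠ u ∧ x.1 ≠ v := fun x hx =>
    let h := (Finset.mem_filter.1 hx).2
    ⟨h.1, h.2.1⟩
  have htarget : ((Fintype.card (Entrants A) : ℝ) - 3) * ((Fintype.card (Entrants A) : ℝ) - 4) =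
      ((#O : ℝ) - 1) * ((#O : ℝ) - 2) := by
    rw [hOr]; ring
  rw [htarget]
  have hthA : threats p u v A ⊆ A := Finset.filter_subset _ _
  by_cases hA4 : #A ≤ 4
  · -- the opponents of `u` and `v` are then all the remaining entrants
    have hO2 : #O = 2 := by
      have h1 : Nat.clog 2 #A ≤ 2 := Nat.clog_le_of_le_pow hA4
      have h2 : Fintype.card (Entrants A) ≤ 2 ^ 2 := by
        rw [card_entrants]
        exact Nat.pow_le_pow_right (by norm_num) h1
      omega
    rw [hO2]
    norm_num
    refine Finset.sum_nonpos fun x hx => ?_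
    rw [Finset.mem_offDiag] at hx
    have hO' : O = {x.1, x.2} := by
      refine (Finset.eq_of_subset_of_card_le ?_ ?_).symm
      · intro y hy
        rcases Finset.mem_insert.1 hy with rfl | hy
        · exact hx.1
        · rw [Finset.mem_singleton.1 hy]; exact hx.2.1
      · rw [hO2, Finset.card_pair hx.2.2]
    rw [surviveBound, if_neg]
    rintro ⟨y, hy, h1, h2⟩
    have := hmemO y (hthmem y hy).1 (hthmem y hy).2
    rw [hO'] at this
    simp [h1, h2] at this
  have hA5 : 2 < #((A.erase u).erase v) := by
    rw [Finset.card_erase_of_mem (Finset.mem_erase.2 ⟨huv.symm, hv⟩), Finset.card_erase_of_mem hu]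
    omega
  obtain ⟨x₁, hx₁⟩ := hne
  by_cases hone : ∃ x₂ ∈ threats p u v A, x₂ ≠ x₁
  · obtain ⟨x₂, hx₂, h12⟩ := hone
    have hsub : ∃ x₃ ∈ (A.erase u).erase v, x₃ ∉ ({x₁, x₂} : Finset (Fin n)) := by
      by_contra! hcon
      have := Finset.card_le_card hcon
      rw [Finset.card_pair h12.symm] at this
      omega
    obtain ⟨x₃, hx₃, h3⟩ := hsub
    simp only [Finset.mem_insert, Finset.mem_singleton, not_or] at h3
    simp only [Finset.mem_erase] at hx₃
    have hxu₁ := hthmem ⟨x₁, hthA hx₁⟩ hx₁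
    have hxu₂ := hthmem ⟨x₂, hthA hx₂⟩ hx₂
    refine (Finset.sum_le_sum fun x _ => surviveBound_le hp x.1 x.2).trans ?_
    exact sum_offDiag_mul_le (fun x _ => passProb_mem hp u x) (fun x _ => passProb_mem hp v x) hb
      hba hab (hmemO ⟨x₁, hthA hx₁⟩ hxu₁.1 hxu₁.2) (hmemO ⟨x₂, hthA hx₂⟩ hxu₂.1 hxu₂.2)
      (hmemO ⟨x₃, hx₃.2.2⟩ hx₃.2.1 hx₃.1) (by simpa using h12.symm)
      (by simpa using fun h => h3.1 h.symm) (by simpa using fun h => h3.2 h.symm)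
      (hpu x₁ hxu₁.1 hxu₁.2) (hpu x₂ hxu₂.1 hxu₂.2) (hpu x₃ hx₃.2.1 hx₃.1)
      (hth x₁ hx₁) (hth x₂ hx₂) (hpv x₃ hx₃.2.1 hx₃.1)
  · -- the only threat must not play `u` or `v`
    push Not at hone
    have hX : (Sum.inl ⟨x₁, hthA hx₁⟩ : Entrants A) ∈ O :=
      hmemO ⟨x₁, hthA hx₁⟩ (hthmem ⟨x₁, hthA hx₁⟩ hx₁).1 (hthmem ⟨x₁, hthA hx₁⟩ hx₁).2
    set X : Entrants A := Sum.inl ⟨x₁, hthA hx₁⟩ with hXdef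
    have h1 : ∑ x ∈ O.offDiag, surviveBound p u v x.1 x.2 =
        ∑ x ∈ (O.erase X).offDiag, surviveBound p u v x.1 x.2 := by
      refine (Finset.sum_subset (Finset.offDiag_mono (Finset.erase_subset _ _)) ?_).symm
      intro x hx hx'
      rw [surviveBound, if_neg]
      rintro ⟨y, hy, h1, h2⟩
      have hyX : Sum.inl y = X := congrArg Sum.inl (Subtype.ext (hone y.1 hy))
      rw [hyX] at h1 h2
      rw [Finset.mem_offDiag] at hx
      refine hx' ?_
      exact Finset.mem_offDiag.2 ⟨Finset.mem_erase.2 ⟨h1.symm, hx.1⟩,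
        Finset.mem_erase.2 ⟨h2.symm, hx.2.1⟩, hx.2.2⟩
    rw [h1]
    refine (Finset.sum_le_card_nsmul _ _ 1 fun x _ => surviveBound_le_one hp x.1 x.2).trans ?_
    rw [nsmul_eq_mul, mul_one, Finset.offDiag_card, Finset.card_erase_of_mem hX]
    have h2 : #O - 1 ≤ (#O - 1) * (#O - 1) := Nat.le_mul_self _
    have h3 : 1 ≤ #O := by omega
    push_cast [h2, h3]
    apply le_of_eq
    ring

end Opponents

/-- Deciding the match between `u` and `v` in favour of `u` instead of `v` gains the coalition
`{u, v}` at most a third of `a - b`, if `u` and `v` beat each other team with probability at most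
`a` and `v` does so with probability at least `b`, and exactly `b` for the threats, the teams against
which `u` has better chances than `v`. Without threats nothing is gained. -/
theorem pairGain_le {p q : Match n → ℝ} {a b : ℝ} {u v : Fin n}
    (hp : ∀ e, p e ∈ Set.Icc (0 : ℝ) 1) (hpq : ∀ e ∉ matchOf u v, p e = q e) (huv : u ≠ v)
    (hp1 : beatProb p u v = 1) (hq0 : beatProb q u v = 0)
    (hb : 0 ≤ b) (hba : b ≤ a) (hab : a + b = 1)
    (hpu : ∀ w, w ≠ u → w ≠ v → beatProb p u w ≤ a)
    (hpv : ∀ w, w ≠ u → w ≠ v → beatProb p v w ∈ Set.Icc b a)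
    (hth : ∀ w, w ≠ u → w ≠ v → beatProb p v w < beatProb p u w → beatProb p v w ≤ b)
    (A : Finset (Fin n)) :
    pairGain p q u v A ≤ (a - b) / 3 ∧
      (threats p u v A = ∅ → pairGain p q u v A ≤ 0) := by
  have hc : 0 ≤ (a - b) / 3 := by linarith
  induction A using Finset.strongInduction with
  | H A ih =>
    by_cases huvA : ¬ (u ∈ A ∧ v ∈ A)
    · rw [pairGain_eq_zero hpq huvA]
      exact ⟨hc, fun _ => le_rfl⟩
    obtain ⟨hu, hv⟩ := not_not.1 huvA
    have hA : 1 < #A := Finset.one_lt_card.2 ⟨u, hu, v, hv, huv⟩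
    have IH : ∀ (D : Tournament n) M, pairGain p q u v (D.survivors A M) ≤ (a - b) / 3 ∧
        (threats p u v (D.survivors A M) = ∅ → pairGain p q u v (D.survivors A M) ≤ 0) :=
      fun D M => ih _ ((D.survivors_subset A M).ssubset_of_ne
        fun h => (D.card_survivors_lt hA M).ne (by rw [h]))
    have hmono : ∀ (D : Tournament n) M, threats p u v (D.survivors A M) ⊆ threats p u v A :=
      fun D M =>
      Finset.filter_subset_filter _ (D.survivors_subset A M)
    -- the teams that may be left when `u` or `v` has eliminated the other
    have hrest : ∀ (D : Tournament n) M,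
        u ∉ D.otherSurvivors A M u ∧ D.otherSurvivors A M u ⊆ A := fun D M =>
      ⟨not_mem_otherSurvivors D A M u, otherSurvivors_subset D M hu⟩
    have hrestv : ∀ (D : Tournament n) M, M.1 (Sum.inl ⟨u, hu⟩) = Sum.inl ⟨v, hv⟩ →
        v ∉ D.otherSurvivors A M u := by
      intro D M hM hmem
      obtain ⟨-, h1, h2, -⟩ := (mem_otherSurvivors D M hu v).1 hmem
      exact h2 ((opp_eq_iff M).1 hM)
    have hmeet := fun (D : Tournament n) M hM => winBracket_sub_le (C := D.otherSurvivors A M u) hp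
      hb hba hab (hrest D M).1 (hrestv D M hM)
      (fun w hw => hpu w (fun h => (hrest D M).1 (h ▸ hw)) fun h => hrestv D M hM (h ▸ hw))
      (fun w hw => (hpv w (fun h => (hrest D M).1 (h ▸ hw)) fun h => hrestv D M hM (h ▸ hw)).1)
    have hpos := card_matchings_pos hA
    rw [pairGain_step p q u v hA]
    have hzero : threats p u v A = ∅ → (∑ M : PerfectMatching (Entrants A),
      (mean p (fun ω => winBracket p ((ofOutcomes ω).survivors A M) u) +
        mean p (fun ω => winBracket p ((ofOutcomes ω).survivors A M) v) -
      (mean q (fun ω => winBracket q ((ofOutcomes ω).survivors A M) u) +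
        mean q (fun ω => winBracket q ((ofOutcomes ω).survivors A M) v)))) /
      (Fintype.card (PerfectMatching (Entrants A)) : ℝ) ≤ 0 := by
      intro hempty
      refine div_nonpos_of_nonpos_of_nonneg (Finset.sum_nonpos fun M _ => ?_) hpos.le
      by_cases hM : M.1 (Sum.inl ⟨u, hu⟩) = Sum.inl ⟨v, hv⟩
      · rw [round_gain_of_opp hpq huv hp1 hq0 hu hv hM]
        refine mean_le hp fun ω => (hmeet (ofOutcomes ω) M hM).2 fun w hw => ?_
        by_contra! hlt
        have : w ∈ threats p u v A := Finset.mem_filter.2 ⟨(hrest _ M).2 hw,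
          fun h => (hrest _ M).1 (h ▸ hw), fun h => hrestv _ M hM (h ▸ hw), hlt⟩
        simp [hempty] at this
      · rw [round_gain_of_not_opp hpq hu hv hM]
        refine mean_le hp fun ω => (IH (ofOutcomes ω) M).2 ?_
        exact Finset.subset_empty.1 (hempty ▸ hmono _ M)
    refine ⟨?_, hzero⟩
    by_cases hempty : threats p u v A = ∅
    · exact (hzero hempty).trans hc
    have hne := Finset.nonempty_iff_ne_empty.2 hempty
    have hcard : 4 ≤ Fintype.card (Entrants A) := by
      obtain ⟨x, hx⟩ := hne
      obtain ⟨hxA, hxu, hxv, -⟩ := Finset.mem_filter.1 hx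
      have h3 : 2 < #A := Finset.two_lt_card.2 ⟨u, hu, v, hv, x, hxA, huv, hxu.symm, hxv.symm⟩
      have h1 : 1 < Nat.clog 2 #A := (Nat.lt_clog_iff_pow_lt (by norm_num)).2 (by simpa using h3)
      rw [card_entrants]
      calc 4 = 2 ^ 2 := by norm_num
        _ ≤ _ := Nat.pow_le_pow_right (by norm_num) h1
    rw [div_le_iff₀ hpos]
    refine PerfectMatching.sum_le_of_opponents (u := (Sum.inl ⟨u, hu⟩ : Entrants A))
      (v := Sum.inl ⟨v, hv⟩) (φ := surviveBound p u v) (by simpa using huv) hcard hc ?_ ?_ ?_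
    · intro M hM
      rw [round_gain_of_opp hpq huv hp1 hq0 hu hv hM]
      refine mean_le hp fun ω => ?_
      have := (hmeet (ofOutcomes ω) M hM).1
      linarith
    · intro M hM
      rw [round_gain_of_not_opp hpq hu hv hM, surviveBound]
      split_ifs with hleft
      · rw [← mean_both_survive p huv hu hv hM, ← mean_mul_left]
        refine mean_mono hp fun ω => ?_
        split_ifs with h
        · rw [mul_one]; exact (IH (ofOutcomes ω) M).1
        · rw [pairGain_eq_zero hpq h, mul_zero]
      · rw [mul_zero]
        refine mean_le hp fun ω => ?_
        by_cases h : u ∈ (ofOutcomes ω).survivors A M ∧ v ∈ (ofOutcomes ω).survivors A M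
        · refine (IH (ofOutcomes ω) M).2 (Finset.eq_empty_of_forall_notMem fun x hx => hleft ?_)
          obtain ⟨hxs, hxu, hxv, hlt⟩ := Finset.mem_filter.1 hx
          have hxA := survivors_subset _ A M hxs
          refine ⟨⟨x, hxA⟩, hmono _ M hx, fun hy => ?_, fun hy => ?_⟩
          · -- a threat that plays `u` is eliminated when `u` survives
            rw [survivors_eq_insert _ M h.1, Finset.mem_insert, mem_otherSurvivors _ M hu] at hxs
            rcases hxs with hxs | ⟨-, _, h2, -⟩
            · exact hxu hxs
            · exact h2 ((opp_eq_iff M).1 hy.symm)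
          · rw [survivors_eq_insert _ M h.2, Finset.mem_insert, mem_otherSurvivors _ M hv] at hxs
            rcases hxs with hxs | ⟨-, _, h2, -⟩
            · exact hxv hxs
            · exact h2 ((opp_eq_iff M).1 hy.symm)
        · rw [pairGain_eq_zero hpq h]
    · exact sum_surviveBound_le hp hb hba hab huv hu hv hpu (fun w h1 h2 => (hpv w h1 h2).2)
        (fun w hw => by
          obtain ⟨-, h1, h2, h3⟩ := Finset.mem_filter.1 hw
          exact hth w h1 h2 h3) hne hcard

end Tournament

/-! ### Independent tournaments as products of Bernoulli distributions -/

namespace Tournament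

open BernoulliProduct

variable {n : ℕ}

theorem ext_of_lt {D D' : Tournament n} (h : ∀ i j, i < j → D.beats i j = D'.beats i j) :
    D = D' := by
  obtain ⟨f, hf1, hf2⟩ := D
  obtain ⟨g, hg1, hg2⟩ := D'
  have : f = g := by
    funext i j
    rcases lt_trichotomy i j with hij | rfl | hij
    · exact h i j hij
    · rw [hf1, hg1]
    · rw [hf2 j i hij.ne, hg2 j i hij.ne]
      exact congrArg (!·) (h j i hij)
  subst this
  rfl

/-- A tournament amounts to the outcomes of its matches. -/
def outcomesEquiv (n : ℕ) : (Match n → Bool) ≃ Tournament n where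
  toFun := ofOutcomes
  invFun D e := D.beats e.1.1 e.1.2
  left_inv ω := by
    funext e
    simp [ofOutcomes, e.2]
  right_inv D := ext_of_lt fun i j h => by simp [ofOutcomes, h]

theorem ofOutcomes_beats (ω : Match n → Bool) (e : Match n) :
    (ofOutcomes ω).beats e.1.1 e.1.2 = ω e := congrFun ((outcomesEquiv n).left_inv ω) e

instance instFintype (n : ℕ) : Fintype (Tournament n) := Fintype.ofEquiv _ (outcomesEquiv n)

instance instDiscreteMeasurableSpace (n : ℕ) : DiscreteMeasurableSpace (Tournament n) :=
  ⟨fun _ => MeasurableSpace.measurableSet_top⟩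

end Tournament

namespace IndepTournament

open BernoulliProduct Tournament

variable {n : ℕ}

/-- The win probability of the smaller team, in each match. -/
noncomputable def prob (T : IndepTournament n) (e : Match n) : ℝ := T.winProb e.1.1 e.1.2

theorem winProb_mem (T : IndepTournament n) (i j : Fin n) : T.winProb i j ∈ Set.Icc (0 : ℝ) 1 :=
  ⟨measureReal_nonneg, measureReal_le_one⟩

theorem winProb_add (T : IndepTournament n) {i j : Fin n} (h : i ≠ j) :
    T.winProb i j + T.winProb j i = 1 := by
  have hc : {D : Tournament n | D.beats j i = true} = {D : Tournament n | D.beats i j = true}ᶜ := by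
    ext D
    exact beats_or h
  rw [winProb, winProb, hc, probReal_compl_eq_one_sub MeasurableSpace.measurableSet_top]
  ring

/-- The law of an independent tournament is determined by its match probabilities. -/
theorem law_ofOutcomes (T : IndepTournament n) (ω : Match n → Bool) :
    (T.law (ofOutcomes ω)).toReal = weight T.prob ω := by
  classical
  let B : Match n → Set (Tournament n) := fun e => {D | D.beats e.1.1 e.1.2 = true}
  have hs : ({ofOutcomes ω} : Set (Tournament n)) =
      ⋂ e, if ω e = true then B e else (B e)ᶜ := by
    ext D
    simp only [Set.mem_singleton_iff, Set.mem_iInter]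
    constructor
    · rintro rfl e
      split_ifs with h
      · exact (ofOutcomes_beats ω e).trans h
      · exact fun h' => h ((ofOutcomes_beats ω e).symm.trans h')
    · intro h
      refine ext_of_lt fun i j hij => ?_
      have h1 := h ⟨(i, j), hij⟩
      have h2 := ofOutcomes_beats ω ⟨(i, j), hij⟩
      simp only at h2
      rw [h2]
      split_ifs at h1 with h3
      · rw [h3]; exact h1
      · rw [Bool.eq_false_iff.2 h3]
        exact Bool.eq_false_iff.2 h1
  have hind := ((iIndepSet_iff_iIndep _ _).1 T.indep).meas_iInter
    (s := fun e => if ω e = true then B e else (B e)ᶜ) fun e => by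
      have hB : MeasurableSet[MeasurableSpace.generateFrom {B e}] (B e) :=
        MeasurableSpace.measurableSet_generateFrom rfl
      split_ifs
      · exact hB
      · exact hB.compl
  have hsingle : T.law.toMeasure {ofOutcomes ω} = T.law (ofOutcomes ω) :=
    PMF.toMeasure_apply_singleton _ _ MeasurableSpace.measurableSet_top
  rw [← hsingle, hs, hind, ENNReal.toReal_prod]
  refine Finset.prod_congr rfl fun e _ => ?_
  split_ifs
  · rfl
  · exact probReal_compl_eq_one_sub MeasurableSpace.measurableSet_top

theorem coalitionProb_eq_mean (r : TournamentRule) [NeZero n] (S : Finset (Fin n))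
    (T : IndepTournament n) :
    r.coalitionProb S T = mean T.prob fun ω => ∑ i ∈ S, (r n (ofOutcomes ω) i).toReal := by
  rw [mean_sum]
  refine Finset.sum_congr rfl fun i _ => ?_
  rw [PMF.bind_apply, tsum_fintype, ENNReal.toReal_sum fun D _ =>
    ENNReal.mul_ne_top (PMF.apply_ne_top _ _) (PMF.apply_ne_top _ _), mean,
    ← Equiv.sum_comp (outcomesEquiv n)]
  refine Finset.sum_congr rfl fun ω _ => ?_
  rw [ENNReal.toReal_mul]
  exact congrArg (· * _) (T.law_ofOutcomes ω)

theorem prob_mem (T : IndepTournament n) (e : Match n) : T.prob e ∈ Set.Icc (0 : ℝ) 1 :=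
  T.winProb_mem _ _

theorem mean_prod_coins (p : Match n → ℝ) (s : Finset (Match n)) :
    mean p (fun ω => ∏ e ∈ s, if ω e = true then 1 else 0) = ∏ e ∈ s, p e := by
  induction s using Finset.induction_on with
  | empty => simp [mean_const]
  | insert e s he ih =>
    simp_rw [Finset.prod_insert he]
    rw [mean_mul (s := {e}) (t := (s : Set (Match n))), mean_coin, ih]
    · simpa using he
    · intro ω ω' h
      simp only [h e rfl]
    · intro ω ω' h
      exact Finset.prod_congr rfl fun e' he' => by rw [h e' he']

/-- The law of the tournament with independent matches of given probabilities. -/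
noncomputable def productLaw (p : Match n → ℝ) (hp : ∀ e, p e ∈ Set.Icc (0 : ℝ) 1) :
    PMF (Tournament n) :=
  PMF.ofFintype (fun D => ENNReal.ofReal (weight p ((outcomesEquiv n).symm D))) <| by
    rw [← ENNReal.ofReal_sum_of_nonneg fun D _ => weight_nonneg hp _,
      Equiv.sum_comp (outcomesEquiv n).symm, sum_weight, ENNReal.ofReal_one]

open Classical in
theorem productLaw_toMeasure (p : Match n → ℝ) (hp : ∀ e, p e ∈ Set.Icc (0 : ℝ) 1)
    (E : Set (Tournament n)) : (productLaw p hp).toMeasure E =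
      ENNReal.ofReal (mean p fun ω => if ofOutcomes ω ∈ E then 1 else 0) := by
  rw [PMF.toMeasure_apply_fintype, mean,
    ENNReal.ofReal_sum_of_nonneg fun ω _ =>
      mul_nonneg (weight_nonneg hp ω) (by split_ifs <;> simp),
    ← Equiv.sum_comp (outcomesEquiv n)]
  refine Finset.sum_congr rfl fun ω _ => ?_
  change E.indicator _ (ofOutcomes ω) = _
  by_cases h : ofOutcomes ω ∈ E
  · rw [Set.indicator_of_mem h, if_pos h, mul_one]
    exact congrArg (fun ω => ENNReal.ofReal (weight p ω)) ((outcomesEquiv n).left_inv ω)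
  · rw [Set.indicator_of_notMem h, if_neg h, mul_zero, ENNReal.ofReal_zero]

theorem productLaw_beats (p : Match n → ℝ) (hp : ∀ e, p e ∈ Set.Icc (0 : ℝ) 1) (e : Match n) :
    (productLaw p hp).toMeasure {D | D.beats e.1.1 e.1.2 = true} = ENNReal.ofReal (p e) := by
  rw [productLaw_toMeasure, ← mean_coin p e]
  simp only [Set.mem_ofPred_eq, ofOutcomes_beats]

/-- The independent tournament with given match probabilities. -/
noncomputable def ofProb (p : Match n → ℝ) (hp : ∀ e, p e ∈ Set.Icc (0 : ℝ) 1) :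
    IndepTournament n where
  law := productLaw p hp
  indep := by
    rw [iIndepSet_iff_meas_biInter fun _ => MeasurableSpace.measurableSet_top]
    intro s
    simp_rw [productLaw_beats]
    rw [productLaw_toMeasure, ← ENNReal.ofReal_prod_of_nonneg fun e _ => (hp e).1,
      ← mean_prod_coins]
    congr 2
    funext ω
    simp only [Set.mem_iInter, Set.mem_ofPred_eq, ofOutcomes_beats, Finset.prod_ite_zero,
      Finset.prod_const_one]

theorem prob_ofProb (p : Match n → ℝ) (hp : ∀ e, p e ∈ Set.Icc (0 : ℝ) 1) :
    (ofProb p hp).prob = p := by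
  funext e
  rw [prob, winProb, Measure.real]
  change ((productLaw p hp).toMeasure _).toReal = _
  rw [productLaw_beats, ENNReal.toReal_ofReal (hp e).1]

end IndepTournament

/-! ### The upper bound -/

namespace Tournament

open BernoulliProduct

variable {n : ℕ}

theorem champProb_eq_one_of_isCondorcetWinner {D : Tournament n} {i : Fin n}
    (h : D.IsCondorcetWinner i) {A : Finset (Fin n)} (hi : i ∈ A) : D.champProb A i = 1 := by
  induction A using Finset.strongInduction with
  | H A ih =>
    by_cases hA : 1 < #A
    · have hs : ∀ M, D.champProb (D.survivors A M) i = 1 := by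
        intro M
        refine ih _ ((D.survivors_subset A M).ssubset_of_ne
          fun h => (D.card_survivors_lt hA M).ne (by rw [h])) ?_
        rw [mem_survivors_of_mem D M hi]
        rcases hb : M.1 (Sum.inl ⟨i, hi⟩) with b | d
        · exact h b fun hbi => opp_ne M (Sum.inl ⟨i, hi⟩) (by
            rw [hb]; exact congrArg Sum.inl (Subtype.ext hbi))
        · rfl
      have hpos := card_matchings_pos hA
      rw [champProb_step D hA, Finset.sum_congr rfl fun M _ => hs M]
      simp only [Finset.sum_const, Finset.card_univ, nsmul_eq_mul, mul_one]
      exact div_self hpos.ne'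
    · obtain ⟨x, rfl⟩ := card_eq_one_of_not hA ⟨i, hi⟩
      rw [champProb_singleton, if_pos (Finset.mem_singleton.1 hi)]

theorem RSEB_toReal [NeZero n] (D : Tournament n) (i : Fin n) :
    (RSEB n D i).toReal = D.champProb univ i := by
  rw [champProb, dif_pos univ_nonempty]
  rfl

theorem RSEB_condorcetConsistent : RSEB.CondorcetConsistent := by
  intro n _ D i h
  have := champProb_eq_one_of_isCondorcetWinner h (mem_univ i)
  rwa [← RSEB_toReal, ENNReal.toReal_eq_one_iff] at this

theorem beatProb_vertex {p : Match n → ℝ} {a b : ℝ} (hab : a + b = 1) {i j : Fin n} (hij : i ≠ j)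
    (h : ∀ e ∈ matchOf i j, p e = a ∨ p e = b) : beatProb p i j = a ∨ beatProb p i j = b := by
  rcases lt_or_gt_of_ne hij with h' | h'
  · simpa only [beatProb, dif_pos h'] using h _ (Or.inl ⟨rfl, rfl⟩)
  · simp only [beatProb, dif_neg h'.not_gt, dif_pos h']
    rcases h ⟨(j, i), h'⟩ (Or.inr ⟨rfl, rfl⟩) with h1 | h1 <;> rw [h1]
    · right; linarith
    · left; linarith

theorem pairGain_le_of_vertex {p q : Match n → ℝ} {a b : ℝ} {u v : Fin n}
    (hp : ∀ e, p e ∈ Set.Icc (0 : ℝ) 1) (hpq : ∀ e ∉ matchOf u v, p e = q e) (huv : u ≠ v)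
    (hp1 : beatProb p u v = 1) (hq0 : beatProb q u v = 0)
    (hb : 0 ≤ b) (hba : b ≤ a) (hab : a + b = 1)
    (hV : ∀ e ∉ matchOf u v, p e = a ∨ p e = b) (A : Finset (Fin n)) :
    pairGain p q u v A ≤ (a - b) / 3 := by
  have hdisj : ∀ w, w ≠ u → w ≠ v → (beatProb p u w = a ∨ beatProb p u w = b) ∧
      (beatProb p v w = a ∨ beatProb p v w = b) := by
    intro w hwu hwv
    refine ⟨beatProb_vertex hab hwu.symm fun e he => hV e fun he' => ?_,
      beatProb_vertex hab hwv.symm fun e he => hV e fun he' => ?_⟩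
    · exact Set.disjoint_left.1
        (disjoint_matchOf (i := u) (j := v) (k := u) (l := w) (Or.inr hwv) (Or.inl huv)) he' he
    · exact Set.disjoint_left.1
        (disjoint_matchOf (i := u) (j := v) (k := v) (l := w) (Or.inl huv.symm) (Or.inr hwu)) he' he
  refine (pairGain_le hp hpq huv hp1 hq0 hb hba hab (fun w h1 h2 => ?_) (fun w h1 h2 => ?_)
    (fun w h1 h2 hlt => ?_) A).1
  · rcases (hdisj w h1 h2).1 with h | h <;> linarith
  · rcases (hdisj w h1 h2).2 with h | h <;> rw [h]
    · exact ⟨hba, le_rfl⟩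
    · exact ⟨le_rfl, hba⟩
  · rcases (hdisj w h1 h2).2 with h | h
    · rcases (hdisj w h1 h2).1 with h' | h' <;> linarith
    · exact h.le

/-- The difference that the outcome of the match `e` makes to the winning probability of its two
teams, in either direction, is at most `(a - b) / 3`. -/
theorem abs_mean_sub_le {a b : ℝ} (hb : 0 ≤ b) (hba : b ≤ a) (hab : a + b = 1)
    {p : Match n → ℝ} (hp : ∀ e, p e ∈ Set.Icc b a) {u v : Fin n} (huv : u < v)
    {F : (Match n → Bool) → ℝ}
    (hF : ∀ ω, F ω = (ofOutcomes ω).champProb univ u + (ofOutcomes ω).champProb univ v) :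
    |mean (Function.update p ⟨(u, v), huv⟩ 1) F - mean (Function.update p ⟨(u, v), huv⟩ 0) F| ≤
      (a - b) / 3 := by
  set e₀ : Match n := ⟨(u, v), huv⟩ with he₀
  have hmatch : ∀ e ∉ matchOf u v, e ≠ e₀ := by
    rintro e he rfl
    exact he (Or.inl ⟨rfl, rfl⟩)
  have hmatch' : ∀ e ∉ matchOf v u, e ≠ e₀ := by
    intro e he
    exact hmatch e (by rwa [matchOf_comm])
  have hFeq : ∀ q, mean q F = winBracket q univ u + winBracket q univ v := by
    intro q
    simp only [winBracket, ← mean_add, ← hF]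
  have haffine : ∀ c d : ℝ, ∀ (p : Match n → ℝ) e t,
      mean (Function.update (Function.update p e t) e₀ c) F -
          mean (Function.update (Function.update p e t) e₀ d) F =
        t * (mean (Function.update (Function.update p e 1) e₀ c) F -
          mean (Function.update (Function.update p e 1) e₀ d) F) +
        (1 - t) * (mean (Function.update (Function.update p e 0) e₀ c) F -
          mean (Function.update (Function.update p e 0) e₀ d) F) := by
    intro c d p e t
    by_cases h : e = e₀
    · subst h
      simp only [Function.update_idem]
      ring
    · simp only [Function.update_comm h _ _ p, mean_update _ e t]
      ring
  have hp01 : ∀ (q : Match n → ℝ), (∀ e, q e = a ∨ q e = b) → ∀ c : ℝ, c ∈ Set.Icc (0 : ℝ) 1 →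
      ∀ e, Function.update q e₀ c e ∈ Set.Icc (0 : ℝ) 1 := by
    intro q hq c hc e
    by_cases h : e = e₀
    · subst h
      rwa [Function.update_self]
    · rw [Function.update_of_ne h]
      rcases hq e with h | h <;> rw [h] <;> constructor <;> linarith
  have hsame : ∀ (q : Match n → ℝ) (c d : ℝ), ∀ e ≠ e₀,
      Function.update q e₀ c e = Function.update q e₀ d e := by
    intro q c d e h
    rw [Function.update_of_ne h, Function.update_of_ne h]
  have hbeat : ∀ (q : Match n → ℝ) (c : ℝ), beatProb (Function.update q e₀ c) u v = c := by
    intro q c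
    simp [beatProb, huv, he₀]
  have hbeat' : ∀ (q : Match n → ℝ) (c : ℝ), beatProb (Function.update q e₀ c) v u = 1 - c := by
    intro q c
    have := beatProb_add (p := Function.update q e₀ c) huv.ne
    rw [hbeat] at this
    linarith
  have h01 : (0 : ℝ) ∈ Set.Icc (0 : ℝ) 1 := ⟨le_rfl, zero_le_one⟩
  have h11 : (1 : ℝ) ∈ Set.Icc (0 : ℝ) 1 := ⟨zero_le_one, le_rfl⟩
  rw [abs_le', neg_sub]
  constructor
  · refine le_of_vertices (Φ := fun p => mean (Function.update p e₀ 1) F -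
      mean (Function.update p e₀ 0) F) (haffine 1 0) (fun q hq => ?_) hp
    simp only [hFeq]
    exact pairGain_le_of_vertex (hp01 q hq 1 h11) (fun e he => hsame q 1 0 e (hmatch e he)) huv.ne
      (hbeat q 1) (hbeat q 0) hb hba hab
      (fun e he => by rw [Function.update_of_ne (hmatch e he)]; exact hq e) univ
  · refine le_of_vertices (Φ := fun p => mean (Function.update p e₀ 0) F -
      mean (Function.update p e₀ 1) F) (haffine 0 1) (fun q hq => ?_) hp
    simp only [hFeq]
    rw [add_comm (winBracket _ _ u), add_comm (winBracket _ _ u)]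
    exact pairGain_le_of_vertex (hp01 q hq 0 h01) (fun e he => hsame q 0 1 e (hmatch' e he))
      huv.ne' (by rw [hbeat', sub_zero]) (by rw [hbeat', sub_self]) hb hba hab
      (fun e he => by rw [Function.update_of_ne (hmatch' e he)]; exact hq e) univ

end Tournament

open BernoulliProduct Tournament in
/-- No coalition of at most two teams gains more than `ε / 3 + 2 * ε ^ 2 / 3` under RSEB. -/
theorem RSEB_gain_le {ε : ℝ} (hε₀ : 0 ≤ ε) (hε₁ : ε ≤ 1 / 2) {n : ℕ} [NeZero n]
    {T T' : IndepTournament n} {S : Finset (Fin n)} (hT : T ∈ boundedTournaments ε n)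
    (hS : #S ≤ 2) (hadj : IndepTournament.Adjacent S T T') :
    RSEB.coalitionProb S T' - RSEB.coalitionProb S T ≤ ε / 3 + 2 * ε ^ 2 / 3 := by
  have hval : 0 ≤ ε / 3 + 2 * ε ^ 2 / 3 := by positivity
  have hsame : ∀ e : Match n, ¬ (e.1.1 ∈ S ∧ e.1.2 ∈ S) → T'.prob e = T.prob e :=
    fun e he => (hadj _ _ he).symm
  have hbox : ∀ e, T.prob e ∈ Set.Icc (1 / 2 - ε) (1 / 2 + ε) := fun e => hT _ _ e.2.ne
  rw [IndepTournament.coalitionProb_eq_mean, IndepTournament.coalitionProb_eq_mean]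
  by_cases hpair : ∃ u v : Fin n, u < v ∧ S = {u, v}
  · obtain ⟨u, v, huv, rfl⟩ := hpair
    set F : (Match n → Bool) → ℝ :=
      fun ω => ∑ i ∈ {u, v}, (RSEB n (ofOutcomes ω) i).toReal with hFdef
    have hF : ∀ ω, F ω =
        (ofOutcomes ω).champProb univ u + (ofOutcomes ω).champProb univ v := by
      intro ω
      simp only [hFdef]
      rw [Finset.sum_pair huv.ne, RSEB_toReal, RSEB_toReal]
    have habs := abs_mean_sub_le (a := 1 / 2 + ε) (b := 1 / 2 - ε) (by linarith) (by linarith)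
      (by ring) hbox huv hF
    set e₀ : Match n := ⟨(u, v), huv⟩ with he₀
    have hupd : T'.prob = Function.update T.prob e₀ (T'.prob e₀) := by
      funext e
      by_cases h : e = e₀
      · subst h; rw [Function.update_self]
      · rw [Function.update_of_ne h]
        refine hsame e ?_
        rintro ⟨h1, h2⟩
        simp only [Finset.mem_insert, Finset.mem_singleton] at h1 h2
        have h3 := e.2
        refine h (Subtype.ext (Prod.ext ?_ ?_)) <;> simp only [he₀] <;>
          rcases h1 with h1 | h1 <;> rcases h2 with h2 | h2 <;> rw [h1, h2] at h3 <;>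
          first
            | exact h1
            | exact h2
            | exact absurd h3 (lt_irrefl _)
            | exact absurd h3 huv.not_gt
    have h1 := mean_update T.prob e₀ (T.prob e₀) F
    rw [Function.update_eq_self] at h1
    rw [hupd, mean_update T.prob e₀ _ F, h1]
    set X := mean (Function.update T.prob e₀ 1) F
    set Y := mean (Function.update T.prob e₀ 0) F
    obtain ⟨h2, h3⟩ := hbox e₀
    obtain ⟨h4, h5⟩ := T'.prob_mem e₀
    have h6 : |T'.prob e₀ - T.prob e₀| ≤ 1 / 2 + ε := by
      rw [abs_le]; constructor <;> linarith
    calc _ = (T'.prob e₀ - T.prob e₀) * (X - Y) := by ring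
      _ ≤ |T'.prob e₀ - T.prob e₀| * |X - Y| := by rw [← abs_mul]; exact le_abs_self _
      _ ≤ (1 / 2 + ε) * ((1 / 2 + ε - (1 / 2 - ε)) / 3) :=
        mul_le_mul h6 habs (abs_nonneg _) (by linarith)
      _ = _ := by ring
  · have : T'.prob = T.prob := by
      funext e
      refine hsame e fun ⟨h1, h2⟩ => hpair ⟨e.1.1, e.1.2, e.2, ?_⟩
      refine (Finset.eq_of_subset_of_card_le ?_ ?_).symm
      · intro w hw
        rcases Finset.mem_insert.1 hw with rfl | hw
        · exact h1
        · rwa [Finset.mem_singleton.1 hw]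
      · rwa [Finset.card_pair e.2.ne]
    rw [this, sub_self]
    exact hval

/-! ### The lower bound -/

namespace Tournament

open BernoulliProduct

/-- The outcomes of the matches `0`-`1`, `1`-`2` and `0`-`2` among three teams. -/
def threeEquiv : (Match 3 → Bool) ≃ Bool × Bool × Bool where
  toFun ω := (ω ⟨(0, 1), by decide⟩, ω ⟨(1, 2), by decide⟩, ω ⟨(0, 2), by decide⟩)
  invFun x e := if e.1 = (0, 1) then x.1 else if e.1 = (1, 2) then x.2.1 else x.2.2
  left_inv ω := by
    funext e
    obtain ⟨⟨i, j⟩, h⟩ := e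
    fin_cases i <;> fin_cases j <;> first | exact absurd h (by decide) | rfl
  right_inv x := by simp

/-- The tournament on three teams with given outcomes of the matches `0`-`1`, `1`-`2` and
`0`-`2`. -/
def ofThree (x y z : Bool) : Tournament 3 := ofOutcomes (threeEquiv.symm (x, y, z))

/-- The match probabilities of the matches `0`-`1`, `1`-`2` and `0`-`2`. -/
def threeProb (s t w : ℝ) : Match 3 → ℝ :=
  fun e => if e.1 = (0, 1) then s else if e.1 = (1, 2) then t else w

theorem threeProb_mem {s t w c d : ℝ} (hs : s ∈ Set.Icc c d) (ht : t ∈ Set.Icc c d)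
    (hw : w ∈ Set.Icc c d) (e : Match 3) : threeProb s t w e ∈ Set.Icc c d := by
  unfold threeProb
  split_ifs <;> assumption

theorem mean_threeProb (s t w : ℝ) (f : Tournament 3 → ℝ) :
    mean (threeProb s t w) (fun ω => f (ofOutcomes ω)) =
      s * (t * (w * f (ofThree true true true) + (1 - w) * f (ofThree true true false)) +
        (1 - t) * (w * f (ofThree true false true) + (1 - w) * f (ofThree true false false))) +
      (1 - s) * (t * (w * f (ofThree false true true) + (1 - w) * f (ofThree false true false)) +
        (1 - t) * (w * f (ofThree false false true) +
          (1 - w) * f (ofThree false false false))) := by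
  have hw : ∀ x y z, weight (threeProb s t w) (threeEquiv.symm (x, y, z)) =
      (if x = true then s else 1 - s) * ((if y = true then t else 1 - t) *
        (if z = true then w else 1 - w)) := by
    intro x y z
    have huniv : (univ : Finset (Match 3)) =
        {⟨(0, 1), by decide⟩, ⟨(1, 2), by decide⟩, ⟨(0, 2), by decide⟩} := by decide
    rw [weight, huniv, Finset.prod_insert (by decide), Finset.prod_insert (by decide),
      Finset.prod_singleton]
    simp [threeProb, threeEquiv]
  rw [mean, ← Equiv.sum_comp threeEquiv.symm]
  simp only [Fintype.sum_prod_type, Fintype.sum_bool, hw, ofThree]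
  simp
  ring

theorem sum_rule_toReal (r : TournamentRule) {n : ℕ} [NeZero n] (D : Tournament n) :
    ∑ i, (r n D i).toReal = 1 := by
  rw [← ENNReal.toReal_sum fun i _ => PMF.apply_ne_top _ i, ← tsum_fintype (L := .unconditional _),
    PMF.tsum_coe, ENNReal.toReal_one]

theorem rule_of_isCondorcetWinner {r : TournamentRule} (hr : r.CondorcetConsistent) {n : ℕ}
    [NeZero n] {D : Tournament n} {i : Fin n} (h : D.IsCondorcetWinner i) (j : Fin n) :
    (r n D j).toReal = if j = i then 1 else 0 := by
  have h1 : (r n D i).toReal = 1 := by rw [hr n D i h, ENNReal.toReal_one]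
  split_ifs with hj
  · rw [hj, h1]
  · have h2 := sum_rule_toReal r D
    rw [← Finset.add_sum_erase _ _ (mem_univ i), h1] at h2
    have h3 : ∑ k ∈ univ.erase i, (r n D k).toReal = 0 := by linarith
    exact (Finset.sum_eq_zero_iff_of_nonneg fun _ _ => ENNReal.toReal_nonneg).1 h3 j
      (Finset.mem_erase.2 ⟨hj, mem_univ j⟩)

end Tournament

open BernoulliProduct Tournament IndepTournament in
/-- In the cyclic tournament on three teams, in which each team beats the next one with probability
`1 / 2 + ε`, some pair gains at least `ε / 3 + 2 * ε ^ 2 / 3` by fixing its match in favour of the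
weaker team: the three gains add up to three times this value. -/
theorem exists_gain_ge {ε : ℝ} (hε₀ : 0 ≤ ε) (hε₁ : ε ≤ 1 / 2) {r : TournamentRule}
    (hr : r.CondorcetConsistent) :
    ∃ (T T' : IndepTournament 3) (S : Finset (Fin 3)), T ∈ boundedTournaments ε 3 ∧ #S ≤ 2 ∧
      Adjacent S T T' ∧
      ε / 3 + 2 * ε ^ 2 / 3 ≤ r.coalitionProb S T' - r.coalitionProb S T := by
  set a : ℝ := 1 / 2 + ε with ha
  set b : ℝ := 1 / 2 - ε with hb
  have ha01 : a ∈ Set.Icc (0 : ℝ) 1 := ⟨by linarith, by linarith⟩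
  have hb01 : b ∈ Set.Icc (0 : ℝ) 1 := ⟨by linarith, by linarith⟩
  have h01 : (0 : ℝ) ∈ Set.Icc (0 : ℝ) 1 := ⟨le_rfl, zero_le_one⟩
  have h11 : (1 : ℝ) ∈ Set.Icc (0 : ℝ) 1 := ⟨zero_le_one, le_rfl⟩
  let T := ofProb (threeProb a a b) (threeProb_mem ha01 ha01 hb01)
  let T₁ := ofProb (threeProb 0 a b) (threeProb_mem h01 ha01 hb01)
  let T₂ := ofProb (threeProb a 0 b) (threeProb_mem ha01 h01 hb01)
  let T₃ := ofProb (threeProb a a 1) (threeProb_mem ha01 ha01 h11)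
  have hT : T ∈ boundedTournaments ε 3 := by
    intro i j hij
    have hbox : ∀ e, T.prob e ∈ Set.Icc b a := by
      rw [prob_ofProb]
      exact threeProb_mem ⟨by linarith, le_rfl⟩ ⟨by linarith, le_rfl⟩ ⟨le_rfl, by linarith⟩
    rcases lt_or_gt_of_ne hij with h | h
    · exact hbox ⟨(i, j), h⟩
    · have h1 := hbox ⟨(j, i), h⟩
      have h2 := T.winProb_add hij
      have h3 : T.prob ⟨(j, i), h⟩ = T.winProb j i := rfl
      rw [h3] at h1
      obtain ⟨h4, h5⟩ := h1
      constructor <;> linarith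
  have hadj : ∀ (S : Finset (Fin 3)) (T' : IndepTournament 3),
      (∀ e : Match 3, ¬ (e.1.1 ∈ S ∧ e.1.2 ∈ S) → T.prob e = T'.prob e) → Adjacent S T T' := by
    intro S T' h i j hij
    rcases lt_trichotomy i j with hlt | rfl | hlt
    · exact h ⟨(i, j), hlt⟩ hij
    · simp [winProb, Tournament.irrefl]
    · have h1 := T.winProb_add hlt.ne
      have h2 := T'.winProb_add hlt.ne
      have h3 : T.winProb j i = T'.winProb j i := h ⟨(j, i), hlt⟩ fun h => hij h.symm
      linarith
  have hA₁ : Adjacent {0, 1} T T₁ := by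
    refine hadj _ _ fun e he => ?_
    rw [prob_ofProb, prob_ofProb, threeProb, threeProb]
    split_ifs with h1 <;> first | rfl | (rw [h1] at he; exact absurd he (by decide))
  have hA₂ : Adjacent {1, 2} T T₂ := by
    refine hadj _ _ fun e he => ?_
    rw [prob_ofProb, prob_ofProb, threeProb, threeProb]
    split_ifs with h1 h2 <;> first | rfl | (rw [h2] at he; exact absurd he (by decide))
  have hA₃ : Adjacent {0, 2} T T₃ := by
    refine hadj _ _ fun e he => ?_
    rw [prob_ofProb, prob_ofProb, threeProb, threeProb]
    split_ifs with h1 h2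
    · rfl
    · rfl
    · obtain ⟨⟨i, j⟩, h⟩ := e
      revert he h1 h2 h
      fin_cases i <;> fin_cases j <;> simp
  let g : Finset (Fin 3) → Tournament 3 → ℝ := fun S D => ∑ i ∈ S, (r 3 D i).toReal
  have hprob : ∀ (s t w : ℝ) (hp : ∀ e, threeProb s t w e ∈ Set.Icc (0 : ℝ) 1) (S : Finset (Fin 3)),
      r.coalitionProb S (ofProb (threeProb s t w) hp) =
        s * (t * (w * g S (ofThree true true true) + (1 - w) * g S (ofThree true true false)) +
          (1 - t) * (w * g S (ofThree true false true) +
            (1 - w) * g S (ofThree true false false))) +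
        (1 - s) * (t * (w * g S (ofThree false true true) +
            (1 - w) * g S (ofThree false true false)) +
          (1 - t) * (w * g S (ofThree false false true) +
            (1 - w) * g S (ofThree false false false))) := by
    intro s t w hp S
    rw [coalitionProb_eq_mean, prob_ofProb]
    exact mean_threeProb s t w (g S)
  have w0 : ∀ y, (ofThree true y true).IsCondorcetWinner 0 := by
    unfold Tournament.IsCondorcetWinner; decide
  have w1 : ∀ z, (ofThree false true z).IsCondorcetWinner 1 := by
    unfold Tournament.IsCondorcetWinner; decide
  have w2 : ∀ x, (ofThree x false false).IsCondorcetWinner 2 := by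
    unfold Tournament.IsCondorcetWinner; decide
  have c1 := sum_rule_toReal r (ofThree true true false)
  have c2 := sum_rule_toReal r (ofThree false false true)
  rw [Fin.sum_univ_three] at c1 c2
  have hsum : (r.coalitionProb {0, 1} T₁ - r.coalitionProb {0, 1} T) +
      (r.coalitionProb {1, 2} T₂ - r.coalitionProb {1, 2} T) +
      (r.coalitionProb {0, 2} T₃ - r.coalitionProb {0, 2} T) = 3 * (ε / 3 + 2 * ε ^ 2 / 3) := by
    simp only [T, T₁, T₂, T₃, hprob, g]
    simp only [Finset.sum_pair (show (0 : Fin 3) ≠ 1 by decide),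
      Finset.sum_pair (show (1 : Fin 3) ≠ 2 by decide),
      Finset.sum_pair (show (0 : Fin 3) ≠ 2 by decide), rule_of_isCondorcetWinner hr (w0 _),
      rule_of_isCondorcetWinner hr (w1 _), rule_of_isCondorcetWinner hr (w2 _)]
    have e1 : (r 3 (ofThree true true false) 2).toReal = 1 -
        (r 3 (ofThree true true false) 0).toReal - (r 3 (ofThree true true false) 1).toReal := by
      linarith
    have e2 : (r 3 (ofThree false false true) 2).toReal = 1 -
        (r 3 (ofThree false false true) 0).toReal - (r 3 (ofThree false false true) 1).toReal := by
      linarith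
    simp [e1, e2]
    rw [ha, hb]
    ring
  by_contra! hcon
  have h1 := hcon T T₁ {0, 1} hT (by decide) hA₁
  have h2 := hcon T T₂ {1, 2} hT (by decide) hA₂
  have h3 := hcon T T₃ {0, 2} hT (by decide) hA₃
  linarith

/-! ### Manipulability -/

namespace TournamentRule

open BernoulliProduct Tournament IndepTournament

variable {n : ℕ} [NeZero n]

theorem coalitionProb_mem (r : TournamentRule) (S : Finset (Fin n)) (T : IndepTournament n) :
    r.coalitionProb S T ∈ Set.Icc (0 : ℝ) 1 := by
  rw [coalitionProb_eq_mean]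
  refine ⟨le_mean T.prob_mem fun ω => Finset.sum_nonneg fun _ _ => ENNReal.toReal_nonneg,
    mean_le T.prob_mem fun ω => ?_⟩
  rw [← sum_rule_toReal r (ofOutcomes ω)]
  exact Finset.sum_le_univ_sum_of_nonneg fun _ => ENNReal.toReal_nonneg

theorem coalitionGain_le (r : TournamentRule) (S : Finset (Fin n)) (T : IndepTournament n) {c : ℝ}
    (h : ∀ T', Adjacent S T T' → r.coalitionProb S T' - r.coalitionProb S T ≤ c) :
    r.coalitionGain S T ≤ c := by
  refine csSup_le ⟨_, T, fun _ _ _ => rfl, rfl⟩ ?_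
  rintro _ ⟨T', hT', rfl⟩
  exact h T' hT'

theorem le_coalitionGain (r : TournamentRule) (S : Finset (Fin n)) {T T' : IndepTournament n}
    (h : Adjacent S T T') : r.coalitionProb S T' - r.coalitionProb S T ≤ r.coalitionGain S T := by
  refine le_csSup ⟨1, ?_⟩ ⟨T', h, rfl⟩
  rintro _ ⟨T', -, rfl⟩
  linarith [(r.coalitionProb_mem S T').2, (r.coalitionProb_mem S T).1]

theorem le_manipulability {k : ℕ} (r : TournamentRule) {C : TournamentClass} {T : IndepTournament n}
    {S : Finset (Fin n)} (hT : T ∈ C n) (hS : #S ≤ k) :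
    r.coalitionGain S T ≤ manipulability k r C := by
  refine le_csSup ⟨1, ?_⟩ ⟨n, inferInstance, T, S, hT, hS, rfl⟩
  rintro _ ⟨m, _, T, S, -, -, rfl⟩
  exact r.coalitionGain_le S T fun T' _ => by
    linarith [(r.coalitionProb_mem S T').2, (r.coalitionProb_mem S T).1]

end TournamentRule

theorem le_manipulability_of_condorcetConsistent {ε : ℝ} (hε₀ : 0 ≤ ε) (hε₁ : ε ≤ 1 / 2)
    {r : TournamentRule} (hr : r.CondorcetConsistent) :
    ε / 3 + 2 * ε ^ 2 / 3 ≤ TournamentRule.manipulability 2 r (boundedTournaments ε) := by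
  obtain ⟨T, T', S, hT, hS, hadj, h⟩ := exists_gain_ge hε₀ hε₁ hr
  exact h.trans ((r.le_coalitionGain S hadj).trans (r.le_manipulability hT hS))

theorem RSEB_manipulability {ε : ℝ} (hε₀ : 0 ≤ ε) (hε₁ : ε ≤ 1 / 2) :
    TournamentRule.manipulability 2 RSEB (boundedTournaments ε) = ε / 3 + 2 * ε ^ 2 / 3 := by
  refine le_antisymm (csSup_le ?_ ?_)
    (le_manipulability_of_condorcetConsistent hε₀ hε₁ Tournament.RSEB_condorcetConsistent)
  · obtain ⟨T, T', S, hT, hS, -, -⟩ := exists_gain_ge hε₀ hε₁ Tournament.RSEB_condorcetConsistent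
    exact ⟨_, 3, inferInstance, T, S, hT, hS, rfl⟩
  · rintro _ ⟨n, _, T, S, hT, hS, rfl⟩
    exact RSEB.coalitionGain_le S T fun T' hadj => RSEB_gain_le hε₀ hε₁ hT hS hadj

theorem optimalManipulability_eq {ε : ℝ} (hε₀ : 0 ≤ ε) (hε₁ : ε ≤ 1 / 2) :
    TournamentRule.optimalManipulability 2 (boundedTournaments ε) = ε / 3 + 2 * ε ^ 2 / 3 := by
  have hlow : ∀ x ∈ {x | ∃ r : TournamentRule, r.CondorcetConsistent ∧
      x = TournamentRule.manipulability 2 r (boundedTournaments ε)},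
      ε / 3 + 2 * ε ^ 2 / 3 ≤ x := by
    rintro _ ⟨r, hr, rfl⟩
    exact le_manipulability_of_condorcetConsistent hε₀ hε₁ hr
  exact IsLeast.csInf_eq
    ⟨⟨RSEB, Tournament.RSEB_condorcetConsistent, (RSEB_manipulability hε₀ hε₁).symm⟩, hlow⟩

theorem theorem6p3 (ε : ℝ) (hε₀ : 0 ≤ ε) (hε₁ : ε ≤ 1 / 2) :
    RSEB.CondorcetConsistent ∧
    TournamentRule.manipulability 2 RSEB (boundedTournaments ε) =
      TournamentRule.optimalManipulability 2 (boundedTournaments ε) ∧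
    TournamentRule.optimalManipulability 2 (boundedTournaments ε) = ε / 3 + 2 * ε ^ 2 / 3 ∧
    (∀ r : TournamentRule, r.CondorcetConsistent →
      ε / 3 + 2 * ε ^ 2 / 3 ≤ TournamentRule.manipulability 2 r (boundedTournaments ε)) ∧
    IsGreatest {x : ℝ | ∃ (n : ℕ) (_ : NeZero n) (T T' : IndepTournament n) (S : Finset (Fin n)),
        T ∈ boundedTournaments ε n ∧ S.card ≤ 2 ∧ IndepTournament.Adjacent S T T' ∧
        x = RSEB.coalitionProb S T' - RSEB.coalitionProb S T}
      (ε / 3 + 2 * ε ^ 2 / 3) := by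
  refine ⟨Tournament.RSEB_condorcetConsistent, ?_, optimalManipulability_eq hε₀ hε₁,
    fun r hr => le_manipulability_of_condorcetConsistent hε₀ hε₁ hr, ?_, ?_⟩
  · rw [RSEB_manipulability hε₀ hε₁, optimalManipulability_eq hε₀ hε₁]
  · -- a pair that gains at least the value under RSEB gains exactly the value
    obtain ⟨T, T', S, hT, hS, hadj, h⟩ := exists_gain_ge hε₀ hε₁ Tournament.RSEB_condorcetConsistent
    exact ⟨3, inferInstance, T, T', S, hT, hS, hadj,
      le_antisymm h (RSEB_gain_le hε₀ hε₁ hT hS hadj)⟩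
  · rintro _ ⟨n, _, T, T', S, hT, hS, hadj, rfl⟩
    exact RSEB_gain_le hε₀ hε₁ hT hS hadj
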